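/- Let $\mathcal A$ be a unital $C^*$-algebra and let $\mathcal B$ be a von Neumann algebra acting on a Hilbert space $\mathcal H$. All modules are right modules with inner products linear in the second variable. For a pre-Hilbert $\mathcal B$-module $F$ let $F\odot\mathcal H$ be the interior tensor product, i.e. the Hilbert space obtained from $F\otimes\mathcal H$ with $\langle x\otimes h,y\otimes k\rangle=\langle h,\langle x,y\rangle k\rangle$ by dividing out vectors of length zero and completing, and let $L_x h:=x\odot h$. We call $F$ a von Neumann $\mathcal B$-module if $\{L_x : x\in F\}$ is strongly closed in $\mathcal B(\mathcal H,F\odot\mathcal H)$. For pre-Hilbert $\mathcal B$-modules, $\mathcal B^a(F,F')$ denotes the set of adjointable maps $S:F\to F'$, i.e. maps having an adjoint $S^*:F'\to F$ with $\langle Sx,y\rangle=\langle x,S^*y\rangle$ for all $x,y$, and $\mathcal B^a(F):=\mathcal B^a(F,F)$. The algebra $\mathcal B$ is a $\mathcal B$-module with $\langle b,c\rangle=b^*c$. Let $E$ be a Hilbert $\mathcal A$-module, let $E'$ be a von Neumann $\mathcal B$-module, and let $\tau:\mathcal A\to\mathcal B$ be a completely positive linear map, i.e. $\sum_{i,j=1}^n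 b_j^*\tau(a_j^*a_i)b_i\ge 0$ for all $n\in\mathbb N$, $a_1,\dots,a_n\in\mathcal A$, $b_1,\dots,b_n\in\mathcal B$. Let $T:E\to E'$ be a $\tau$-map, i.e. a map with $\langle T(x),T(y)\rangle=\tau(\langle x,y\rangle)$ for all $x,y\in E$. Then there exist: (i) (a) a von Neumann $\mathcal B$-module $F$ and a unital $*$-homomorphism $\pi:\mathcal A\to\mathcal B^a(F)$; (b) a map $V\in\mathcal B^a(\mathcal B,F)$ such that $\tau(a)b=V^*\pi(a)Vb$ for all $a\in\mathcal A$, $b\in\mathcal B$; (ii) (a) a von Neumann $\mathcal B$-module $F'$ and a quasi-representation $\Psi:E\to\mathcal B^a(F,F')$ with which $\pi$ is associated, i.e. a map with $\langle\Psi(y)f_1,\Psi(x)f_2\rangle=\langle\pi(\langle x,y\rangle)f_1,f_2\rangle$ for all $x,y\in E$ and $f_1,f_2\in F$; (b) a coisometry $S$ from $E'$ onto $F'$, i.e. $S\in\mathcal B^a(E',F')$ with $SS^*=\mathrm{id}_{F'}$, such that $T(x)b=S^*\Psi(x)Vb$ for all $x\in E$, $b\in\mathcal B$. -/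

import Mathlib

open scoped TensorProduct

namespace VonNeumannAlgebra

variable {H : Type*} [NormedAddCommGroup H] [InnerProductSpace ℂ H] [CompleteSpace H]

instance instSMulMemClass : SMulMemClass (VonNeumannAlgebra H) ℂ (H →L[ℂ] H) where
  smul_mem {S} r _ hx := S.toStarSubalgebra.smul_mem hx r

theorem isClosed_coe (B : VonNeumannAlgebra H) : IsClosed (B : Set (H →L[ℂ] H)) := by
  rw [← B.centralizer_centralizer]
  exact Set.isClosed_centralizer _

/-- A von Neumann algebra is a unital C⋆-algebra, with the norm of `B(H)`. -/
noncomputable instance instCStarAlgebra (B : VonNeumannAlgebra H) : CStarAlgebra B :=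
  StarSubalgebra.cstarAlgebra B (h_closed := B.isClosed_coe)

/-- The order on `B` is the order of operators on `H`; it is the C⋆-algebra order. -/
instance instStarOrderedRing (B : VonNeumannAlgebra H) : StarOrderedRing B := by
  refine .of_nonneg_iff' (fun {x y} h z ↦ ?_) (fun x ↦ ⟨fun hx ↦ ?_, ?_⟩)
  · exact add_le_add_right (α := H →L[ℂ] H) h z
  · have hx' : (0 : H →L[ℂ] H) ≤ x := hx
    have hmem : CFC.sqrt (x : H →L[ℂ] H) ∈ B := by
      rw [← SetLike.mem_coe, ← B.centralizer_centralizer]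
      intro y hy
      exact ((show Commute (x : H →L[ℂ] H) y from hy _ x.2).cfcₙ_nnreal NNReal.sqrt).eq.symm
    refine ⟨⟨_, hmem⟩, Subtype.ext ?_⟩
    change (x : H →L[ℂ] H) = star (CFC.sqrt (x : H →L[ℂ] H)) * CFC.sqrt (x : H →L[ℂ] H)
    rw [(CFC.sqrt_nonneg (x : H →L[ℂ] H)).star_eq, CFC.sqrt_mul_sqrt_self _ hx']
  · rintro ⟨s, rfl⟩
    exact star_mul_self_nonneg (s : H →L[ℂ] H)

end VonNeumannAlgebra

/-- A (right) pre-Hilbert module `E` over a C⋆-algebra `A`. The right action of `a : A` on `x : E`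
is `MulOpposite.op a • x`; the `A`-valued inner product is linear in the second variable. (Mathlib's
`CStarModule` has `A` acting from the left.) -/
class PreHilbertModule (A E : Type*) [CStarAlgebra A] [PartialOrder A]
    [AddCommGroup E] [Module ℂ E] [Module Aᵐᵒᵖ E] where
  /-- The `A`-valued inner product. -/
  innerProd : E → E → A
  smul_op_smul (c : ℂ) (x : E) (a : A) :
    c • MulOpposite.op a • x = MulOpposite.op a • c • x
  op_smul_smul (c : ℂ) (x : E) (a : A) :
    MulOpposite.op a • c • x = MulOpposite.op (c • a) • x
  innerProd_self_nonneg (x : E) : 0 ≤ innerProd x x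
  eq_zero_of_innerProd_self (x : E) : innerProd x x = 0 → x = 0
  innerProd_op_smul (x y : E) (a : A) : innerProd x (MulOpposite.op a • y) = innerProd x y * a
  star_innerProd (x y : E) : star (innerProd y x) = innerProd x y
  innerProd_add (x y z : E) : innerProd x (y + z) = innerProd x y + innerProd x z
  innerProd_smul (c : ℂ) (x y : E) : innerProd x (c • y) = c • innerProd x y

/-- The `A`-valued inner product of a pre-Hilbert `A`-module. -/
def innerMod (A : Type*) {E : Type*} [CStarAlgebra A] [PartialOrder A]
    [AddCommGroup E] [Module ℂ E] [Module Aᵐᵒᵖ E] [PreHilbertModule A E] (x y : E) : A :=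
  PreHilbertModule.innerProd x y

namespace PreHilbertModule

section Basic

variable {A E : Type*} [CStarAlgebra A] [PartialOrder A]
  [AddCommGroup E] [Module ℂ E] [Module Aᵐᵒᵖ E] [PreHilbertModule A E]

theorem innerMod_self_nonneg (x : E) : 0 ≤ innerMod A x x := innerProd_self_nonneg x

theorem innerMod_op_smul_right (x y : E) (a : A) :
    innerMod A x (MulOpposite.op a • y) = innerMod A x y * a := innerProd_op_smul x y a

theorem star_innerMod (x y : E) : star (innerMod A y x) = innerMod A x y := star_innerProd x y

theorem innerMod_add_right (x y z : E) :
    innerMod A x (y + z) = innerMod A x y + innerMod A x z := innerProd_add x y z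

theorem innerMod_smul_right (c : ℂ) (x y : E) :
    innerMod A x (c • y) = c • innerMod A x y := innerProd_smul c x y

theorem innerMod_add_left (x y z : E) :
    innerMod A (x + y) z = innerMod A x z + innerMod A y z := by
  rw [← star_innerMod, innerMod_add_right, star_add, star_innerMod, star_innerMod]

theorem innerMod_smul_left (c : ℂ) (x y : E) :
    innerMod A (c • x) y = star c • innerMod A x y := by
  rw [← star_innerMod, innerMod_smul_right, star_smul, star_innerMod]

theorem innerMod_op_smul_left (x y : E) (a : A) :
    innerMod A (MulOpposite.op a • x) y = star a * innerMod A x y := by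
  rw [← star_innerMod, innerMod_op_smul_right, star_mul, star_innerMod]

theorem innerMod_zero_right (x : E) : innerMod A x 0 = 0 := by
  simpa using innerMod_smul_right (A := A) 0 x 0

theorem innerMod_zero_left (x : E) : innerMod A 0 x = 0 := by
  simpa using innerMod_smul_left (A := A) 0 0 x

theorem innerMod_neg_right (x y : E) : innerMod A x (-y) = -innerMod A x y := by
  simpa using innerMod_smul_right (A := A) (-1) x y

theorem innerMod_sub_right (x y z : E) :
    innerMod A x (y - z) = innerMod A x y - innerMod A x z := by
  rw [sub_eq_add_neg, innerMod_add_right, innerMod_neg_right, sub_eq_add_neg]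

theorem innerMod_sum_right {ι : Type*} (s : Finset ι) (x : E) (y : ι → E) :
    innerMod A x (∑ i ∈ s, y i) = ∑ i ∈ s, innerMod A x (y i) := by
  classical
  induction s using Finset.induction_on with
  | empty => simp [innerMod_zero_right]
  | insert i s hi ih => rw [Finset.sum_insert hi, Finset.sum_insert hi, innerMod_add_right, ih]

theorem innerMod_sum_left {ι : Type*} (s : Finset ι) (x : ι → E) (y : E) :
    innerMod A (∑ i ∈ s, x i) y = ∑ i ∈ s, innerMod A (x i) y := by
  rw [← star_innerMod, innerMod_sum_right, star_sum]
  exact Finset.sum_congr rfl fun i _ ↦ star_innerMod _ _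

/-- Elements with the same inner products are equal. -/
theorem ext_innerMod {x y : E} (h : ∀ z : E, innerMod A z x = innerMod A z y) : x = y := by
  rw [← sub_eq_zero]
  refine eq_zero_of_innerProd_self (A := A) _ ?_
  change innerMod A (x - y) (x - y) = 0
  rw [innerMod_sub_right, h, sub_self]

end Basic

/-- A C⋆-algebra as a right module over itself, with `⟨a, b⟩ = a* b`. -/
instance instSelf {A : Type*} [CStarAlgebra A] [PartialOrder A] [StarOrderedRing A] :
    PreHilbertModule A A where
  innerProd a b := star a * b
  smul_op_smul c x a := by simp
  op_smul_smul c x a := by simp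
  innerProd_self_nonneg x := star_mul_self_nonneg x
  eq_zero_of_innerProd_self x h := (CStarRing.star_mul_self_eq_zero_iff x).1 h
  innerProd_op_smul x y a := by simp [mul_assoc]
  star_innerProd x y := by simp
  innerProd_add x y z := mul_add _ _ _
  innerProd_smul c x y := by simp

/-- A pre-Hilbert module is a Hilbert module if it is complete for the norm `‖⟨x, x⟩‖ ^ (1/2)`. -/
def IsHilbertModule (A E : Type*) [CStarAlgebra A] [PartialOrder A]
    [AddCommGroup E] [Module ℂ E] [Module Aᵐᵒᵖ E] [PreHilbertModule A E] : Prop :=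
  ∀ u : ℕ → E,
    (∀ ε > 0, ∃ N, ∀ m ≥ N, ∀ n ≥ N, √‖innerMod A (u m - u n) (u m - u n)‖ < ε) →
    ∃ x : E, ∀ ε > 0, ∃ N, ∀ n ≥ N, √‖innerMod A (u n - x) (u n - x)‖ < ε

end PreHilbertModule

/-! ### Adjointable maps -/

/-- The space `B^a(E, F)` of adjointable maps between pre-Hilbert `B`-modules; the adjoint is
unique, so that an adjointable map is determined by its underlying function. -/
structure AdjointableMap (B E F : Type*) [CStarAlgebra B] [PartialOrder B]
    [AddCommGroup E] [Module ℂ E] [Module Bᵐᵒᵖ E] [PreHilbertModule B E]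
    [AddCommGroup F] [Module ℂ F] [Module Bᵐᵒᵖ F] [PreHilbertModule B F] where
  /-- The underlying function. -/
  toFun : E → F
  /-- The adjoint. -/
  adjFun : F → E
  inner_toFun_left (x : E) (y : F) : innerMod B (toFun x) y = innerMod B x (adjFun y)

namespace AdjointableMap

variable {B E F G : Type*} [CStarAlgebra B] [PartialOrder B]
  [AddCommGroup E] [Module ℂ E] [Module Bᵐᵒᵖ E] [PreHilbertModule B E]
  [AddCommGroup F] [Module ℂ F] [Module Bᵐᵒᵖ F] [PreHilbertModule B F]
  [AddCommGroup G] [Module ℂ G] [Module Bᵐᵒᵖ G] [PreHilbertModule B G]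

open PreHilbertModule

instance : CoeFun (AdjointableMap B E F) (fun _ ↦ E → F) := ⟨toFun⟩

/-- The adjoint `S* : F → E` of `S : E → F`. -/
def adjoint (S : AdjointableMap B E F) : AdjointableMap B F E where
  toFun := S.adjFun
  adjFun := S.toFun
  inner_toFun_left x y := by rw [← star_innerMod, ← S.inner_toFun_left, star_innerMod]

theorem inner_left (S : AdjointableMap B E F) (x : E) (y : F) :
    innerMod B (S x) y = innerMod B x (S.adjoint y) := S.inner_toFun_left x y

theorem inner_right (S : AdjointableMap B E F) (x : F) (y : E) :
    innerMod B x (S y) = innerMod B (S.adjoint x) y := (S.adjoint.inner_left x y).symm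

@[ext]
theorem ext {S T : AdjointableMap B E F} (h : ∀ x, S x = T x) : S = T := by
  obtain ⟨f, f', hf⟩ := S
  obtain ⟨g, g', hg⟩ := T
  obtain rfl : f = g := funext h
  obtain rfl : f' = g' := funext fun y ↦ ext_innerMod (A := B) fun z ↦ by rw [← hf, ← hg]
  rfl

theorem map_add (S : AdjointableMap B E F) (x y : E) : S (x + y) = S x + S y :=
  ext_innerMod (A := B) fun z ↦ by
    rw [innerMod_add_right, S.inner_right, S.inner_right, S.inner_right, innerMod_add_right]

theorem map_smul (S : AdjointableMap B E F) (c : ℂ) (x : E) : S (c • x) = c • S x :=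
  ext_innerMod (A := B) fun z ↦ by
    rw [innerMod_smul_right, S.inner_right, S.inner_right, innerMod_smul_right]

theorem map_zero (S : AdjointableMap B E F) : S 0 = 0 := by simpa using S.map_smul 0 0

/-- The composition `S T`. -/
def comp (S : AdjointableMap B F G) (T : AdjointableMap B E F) : AdjointableMap B E G where
  toFun x := S (T x)
  adjFun y := T.adjoint (S.adjoint y)
  inner_toFun_left x y := by rw [S.inner_left, T.inner_left]

instance : Zero (AdjointableMap B E F) where
  zero := ⟨fun _ ↦ 0, fun _ ↦ 0, fun _ _ ↦ by rw [innerMod_zero_left, innerMod_zero_right]⟩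

instance : Add (AdjointableMap B E F) where
  add S T := ⟨fun x ↦ S x + T x, fun y ↦ S.adjoint y + T.adjoint y, fun x y ↦ by
    rw [innerMod_add_left, innerMod_add_right, S.inner_left, T.inner_left]⟩

instance : SMul ℂ (AdjointableMap B E F) where
  smul c S := ⟨fun x ↦ c • S x, fun y ↦ star c • S.adjoint y, fun x y ↦ by
    rw [innerMod_smul_left, innerMod_smul_right, S.inner_left]⟩

instance : Neg (AdjointableMap B E F) where
  neg S := (-1 : ℂ) • S

instance : One (AdjointableMap B E E) where
  one := ⟨fun x ↦ x, fun x ↦ x, fun _ _ ↦ rfl⟩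

instance : Mul (AdjointableMap B E E) where
  mul S T := S.comp T

instance : Star (AdjointableMap B E E) where
  star S := S.adjoint

@[simp] theorem zero_apply (x : E) : (0 : AdjointableMap B E F) x = 0 := rfl
@[simp] theorem add_apply (S T : AdjointableMap B E F) (x : E) : (S + T) x = S x + T x := rfl
@[simp] theorem smul_apply (c : ℂ) (S : AdjointableMap B E F) (x : E) : (c • S) x = c • S x := rfl
@[simp] theorem neg_apply (S : AdjointableMap B E F) (x : E) : (-S) x = -S x :=
  neg_one_smul ℂ (S x)
@[simp] theorem one_apply (x : E) : (1 : AdjointableMap B E E) x = x := rfl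
@[simp] theorem mul_apply (S T : AdjointableMap B E E) (x : E) : (S * T) x = S (T x) := rfl
@[simp] theorem star_eq_adjoint (S : AdjointableMap B E E) : star S = S.adjoint := rfl
@[simp] theorem comp_apply (S : AdjointableMap B F G) (T : AdjointableMap B E F) (x : E) :
    S.comp T x = S (T x) := rfl

instance : AddCommGroup (AdjointableMap B E F) where
  add_assoc S T U := ext fun x ↦ add_assoc _ _ _
  zero_add S := ext fun x ↦ zero_add _
  add_zero S := ext fun x ↦ add_zero _
  add_comm S T := ext fun x ↦ add_comm _ _
  neg_add_cancel S := ext fun x ↦ by simp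
  nsmul := nsmulRec
  zsmul := zsmulRec

instance : Ring (AdjointableMap B E E) where
  __ := (inferInstance : AddCommGroup (AdjointableMap B E E))
  mul_assoc S T U := rfl
  one_mul S := rfl
  mul_one S := rfl
  left_distrib S T U := ext fun x ↦ S.map_add _ _
  right_distrib S T U := ext fun _ ↦ rfl
  zero_mul S := ext fun _ ↦ rfl
  mul_zero S := ext fun x ↦ S.map_zero

instance : Module ℂ (AdjointableMap B E F) where
  one_smul _ := ext fun _ ↦ one_smul _ _
  mul_smul _ _ _ := ext fun _ ↦ mul_smul _ _ _
  smul_zero _ := ext fun _ ↦ smul_zero _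
  smul_add _ _ _ := ext fun _ ↦ smul_add _ _ _
  add_smul _ _ _ := ext fun _ ↦ add_smul _ _ _
  zero_smul _ := ext fun _ ↦ zero_smul _ _

/-- `B^a(E)` is a unital algebra, and a ⋆-algebra for the adjoint. -/
instance : Algebra ℂ (AdjointableMap B E E) :=
  Algebra.ofModule (fun _ _ _ ↦ ext fun _ ↦ rfl) (fun c S T ↦ ext fun x ↦ S.map_smul c (T x))

instance : StarRing (AdjointableMap B E E) where
  star_involutive _ := rfl
  star_mul _ _ := rfl
  star_add _ _ := ext fun _ ↦ rfl

/-- A coisometry is an adjointable map `S : E → F` with `S S* = 1` (so that `S` is onto). -/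
def IsCoisometry (S : AdjointableMap B E F) : Prop := ∀ y : F, S (S.adjoint y) = y

end AdjointableMap

/-! ### The interior tensor product `E ⊙ H` -/

/-- For self-adjoint `a` and suitable self-adjoint `x`, the element `x a x` is negative, and `a` is
positive as soon as `x a x` vanishes. -/
theorem exists_compress_neg {C : Type*} [CStarAlgebra C] {a : C} (ha : IsSelfAdjoint a) :
    ∃ x z : C, star x * a * x = -(star z * z) ∧ (z = 0 → ∃ y, a = star y * y) := by
  let _ := CStarAlgebra.spectralOrder C
  have := CStarAlgebra.spectralOrderedRing C
  have hn : 0 ≤ a⁻ := CFC.negPart_nonneg a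
  have hp : 0 ≤ a⁺ := CFC.posPart_nonneg a
  have hs := CFC.sqrt_mul_sqrt_self a⁻ hn
  have hsp := CFC.sqrt_mul_sqrt_self a⁺ hp
  have e : a⁺ - a⁻ = a := CFC.posPart_sub_negPart a ha
  have e1 : a⁻ * a = -(a⁻ * a⁻) := by
    calc a⁻ * a = a⁻ * (a⁺ - a⁻) := by rw [e]
      _ = -(a⁻ * a⁻) := by rw [mul_sub, CFC.negPart_mul_posPart, zero_sub]
  refine ⟨a⁻, CFC.sqrt a⁻ * a⁻, ?_, fun hz ↦ ⟨CFC.sqrt a⁺, ?_⟩⟩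
  · rw [star_mul, hn.star_eq, (CFC.sqrt_nonneg a⁻).star_eq, e1]
    rw [mul_assoc a⁻ (CFC.sqrt a⁻), ← mul_assoc (CFC.sqrt a⁻), hs, neg_mul, mul_assoc]
  · have h2 : a⁻ * a⁻ = 0 := by
      rw [← hs, mul_assoc, hs, hz, mul_zero]
    have h3 : a⁻ = 0 := by
      rw [← CStarRing.star_mul_self_eq_zero_iff, hn.star_eq, h2]
    rw [(CFC.sqrt_nonneg _).star_eq, hsp]
    rw [h3, sub_zero] at e
    exact e.symm

/-- A matrix over a C⋆-algebra which is positive on all columns is of the form `Y* Y`. -/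
theorem exists_gram_of_forall_column_nonneg {B : Type*} [CStarAlgebra B] [PartialOrder B]
    [StarOrderedRing B] {n : ℕ} (m : Fin n → Fin n → B) (hm : ∀ i j, star (m i j) = m j i)
    (hpos : ∀ b : Fin n → B, 0 ≤ ∑ i, ∑ j, star (b i) * m i j * b j) :
    ∃ y : Fin n → Fin n → B, ∀ i j, m i j = ∑ k, star (y k i) * y k j := by
  let M : CStarMatrix (Fin n) (Fin n) B := CStarMatrix.ofMatrix (Matrix.of m)
  have hM : IsSelfAdjoint M := by
    ext i j
    exact hm j i
  obtain ⟨x, z, hx, hz⟩ := exists_compress_neg hM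
  have hz0 : z = 0 := by
    have hcol : ∀ j, ∑ k, star (z k j) * z k j = 0 := by
      intro j
      refine le_antisymm ?_ (Finset.sum_nonneg fun k _ ↦ star_mul_self_nonneg _)
      have h1 := congrFun (congrFun hx j) j
      have h2 : (-(star z * z)) j j = -∑ k, star (z k j) * z k j := rfl
      have h3 : (star x * M * x) j j = ∑ i, ∑ l, star (x i j) * m i l * x l j := by
        change ∑ l, (∑ i, star (x i j) * m i l) * x l j = _
        simp_rw [Finset.sum_mul]
        rw [Finset.sum_comm]
      have h4 := hpos fun i ↦ x i j
      rw [← h3, h1, h2] at h4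
      exact neg_nonneg.1 h4
    ext k j
    have := (Finset.sum_eq_zero_iff_of_nonneg fun k _ ↦ star_mul_self_nonneg _).1 (hcol j) k
      (Finset.mem_univ k)
    exact (CStarRing.star_mul_self_eq_zero_iff _).1 this
  obtain ⟨y, hy⟩ := hz hz0
  exact ⟨fun k i ↦ y k i, fun i j ↦ congrFun (congrFun hy i) j⟩

theorem re_sum_inner_gram_nonneg {H : Type*} [NormedAddCommGroup H] [InnerProductSpace ℂ H]
    [CompleteSpace H] {n : ℕ} (y : Fin n → Fin n → H →L[ℂ] H) (h : Fin n → H) :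
    0 ≤ (∑ j, ∑ i, inner ℂ (h i) ((∑ k, star (y k i) * y k j) (h j))).re := by
  have hij (i j : Fin n) : inner ℂ (h i) ((∑ k, star (y k i) * y k j) (h j)) =
      ∑ k, inner ℂ (y k i (h i)) (y k j (h j)) := by
    rw [sum_apply, inner_sum]
    refine Finset.sum_congr rfl fun k _ ↦ ?_
    rw [ContinuousLinearMap.star_eq_adjoint]
    exact ContinuousLinearMap.adjoint_inner_right (y k i) (h i) (y k j (h j))
  have key : ∑ j, ∑ i, inner ℂ (h i) ((∑ k, star (y k i) * y k j) (h j)) =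
      ∑ k, inner ℂ (∑ i, y k i (h i)) (∑ j, y k j (h j)) := by
    calc _ = ∑ j, ∑ k, ∑ i, inner ℂ (y k i (h i)) (y k j (h j)) := by
          refine Finset.sum_congr rfl fun j _ ↦ ?_
          simp_rw [hij]
          exact Finset.sum_comm
      _ = ∑ k, ∑ j, ∑ i, inner ℂ (y k i (h i)) (y k j (h j)) := Finset.sum_comm
      _ = _ := by simp_rw [inner_sum, sum_inner]
  rw [key, Complex.re_sum]
  exact Finset.sum_nonneg fun k _ ↦ inner_self_nonneg (𝕜 := ℂ)

section InteriorTensor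

variable {H : Type*} [NormedAddCommGroup H] [InnerProductSpace ℂ H] [CompleteSpace H]
  (B : VonNeumannAlgebra H) (E : Type*) [AddCommGroup E] [Module ℂ E]

/-- The algebraic tensor product `E ⊗ H` over `ℂ`, to be equipped with the semi-inner product
`⟪x ⊗ h, y ⊗ k⟫ = ⟪h, ⟨x, y⟩ k⟫`. -/
def AlgInteriorTensor (_B : VonNeumannAlgebra H) (E : Type*) [AddCommGroup E] [Module ℂ E] :=
  E ⊗[ℂ] H

namespace AlgInteriorTensor

noncomputable instance : AddCommGroup (AlgInteriorTensor B E) :=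
  inferInstanceAs (AddCommGroup (E ⊗[ℂ] H))
noncomputable instance : Module ℂ (AlgInteriorTensor B E) :=
  inferInstanceAs (Module ℂ (E ⊗[ℂ] H))

variable {E}

/-- The elementary tensor `x ⊗ h`. -/
def tmul (x : E) (h : H) : AlgInteriorTensor B E := x ⊗ₜ[ℂ] h

theorem exists_sum (t : AlgInteriorTensor B E) :
    ∃ (n : ℕ) (x : Fin n → E) (h : Fin n → H), t = ∑ i, tmul B (x i) (h i) := by
  obtain ⟨S, hS⟩ := TensorProduct.exists_finset (R := ℂ) (M := E) (N := H) t
  refine ⟨S.card, fun i ↦ (S.equivFin.symm i).1.1, fun i ↦ (S.equivFin.symm i).1.2, ?_⟩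
  rw [hS, ← Finset.sum_coe_sort, ← S.equivFin.symm.sum_comp]
  rfl

variable (E) [Module (↥B)ᵐᵒᵖ E] [PreHilbertModule B E]

/-- The form `⟪x ⊗ h, y ⊗ k⟫ = ⟪h, ⟨x, y⟩ k⟫` as a sesquilinear map. -/
noncomputable def form : AlgInteriorTensor B E →ₗ⋆[ℂ] AlgInteriorTensor B E →ₗ[ℂ] ℂ :=
  TensorProduct.lift <| LinearMap.mk₂'ₛₗ (starRingEnd ℂ) (starRingEnd ℂ)
    (fun (x : E) (h : H) ↦ (TensorProduct.lift <| LinearMap.mk₂ ℂ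
      (fun (y : E) (k : H) ↦ inner ℂ h ((innerMod B x y : H →L[ℂ] H) k))
      (fun y y' k ↦ by
        rw [PreHilbertModule.innerMod_add_right]
        exact inner_add_right h _ _)
      (fun c y k ↦ by
        rw [PreHilbertModule.innerMod_smul_right]
        exact inner_smul_right h _ c)
      (fun y k k' ↦ by rw [map_add, inner_add_right])
      (fun c y k ↦ by rw [map_smul, inner_smul_right]; rfl) : E ⊗[ℂ] H →ₗ[ℂ] ℂ))
    (fun x x' h ↦ TensorProduct.ext' fun y k ↦ by
      simp only [TensorProduct.lift.tmul, LinearMap.mk₂_apply]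
      rw [PreHilbertModule.innerMod_add_left]
      exact inner_add_right h _ _)
    (fun c x h ↦ TensorProduct.ext' fun y k ↦ by
      simp only [TensorProduct.lift.tmul, LinearMap.mk₂_apply]
      rw [PreHilbertModule.innerMod_smul_left]
      exact inner_smul_right h _ _)
    (fun x h h' ↦ TensorProduct.ext' fun y k ↦ by
      simp only [TensorProduct.lift.tmul, LinearMap.mk₂_apply]
      exact _root_.inner_add_left _ _ _)
    (fun c x h ↦ TensorProduct.ext' fun y k ↦ by
      simp only [TensorProduct.lift.tmul, LinearMap.mk₂_apply]
      exact _root_.inner_smul_left _ _ _)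

theorem form_tmul (x y : E) (h k : H) :
    form B E (tmul B x h) (tmul B y k) = inner ℂ h ((innerMod B x y : H →L[ℂ] H) k) := rfl

variable {E}

theorem form_conj_symm (s t : AlgInteriorTensor B E) :
    starRingEnd ℂ (form B E t s) = form B E s t := by
  obtain ⟨n, x, h, rfl⟩ := exists_sum B s
  obtain ⟨m, y, k, rfl⟩ := exists_sum B t
  simp only [map_sum, LinearMap.sum_apply, form_tmul]
  rw [Finset.sum_comm]
  refine Finset.sum_congr rfl fun i _ ↦ Finset.sum_congr rfl fun j _ ↦ ?_
  rw [inner_conj_symm, ← PreHilbertModule.star_innerMod]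
  exact ContinuousLinearMap.adjoint_inner_left _ _ _

theorem form_self_nonneg (t : AlgInteriorTensor B E) : 0 ≤ (form B E t t).re := by
  obtain ⟨n, x, h, rfl⟩ := exists_sum B t
  obtain ⟨y, hy⟩ := exists_gram_of_forall_column_nonneg (fun i j ↦ innerMod B (x i) (x j))
    (fun i j ↦ PreHilbertModule.star_innerMod _ _) (fun b ↦ by
      have := PreHilbertModule.innerMod_self_nonneg (A := B) (∑ i, MulOpposite.op (b i) • x i)
      rw [PreHilbertModule.innerMod_sum_left] at this
      simpa only [PreHilbertModule.innerMod_sum_right,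
        PreHilbertModule.innerMod_op_smul_left, PreHilbertModule.innerMod_op_smul_right,
        Finset.mul_sum, mul_assoc, Finset.sum_mul] using this)
  have hy' (i j : Fin n) : (innerMod B (x i) (x j) : H →L[ℂ] H) =
      ∑ k, star (y k i : H →L[ℂ] H) * (y k j : H →L[ℂ] H) := by
    rw [hy]
    exact map_sum B.toStarSubalgebra.subtype _ _
  have := re_sum_inner_gram_nonneg (fun k i ↦ (y k i : H →L[ℂ] H)) h
  simpa only [map_sum, LinearMap.sum_apply, form_tmul, hy'] using this

/-- The semi-inner product on `E ⊗ H`. -/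
noncomputable abbrev preCore : PreInnerProductSpace.Core ℂ (AlgInteriorTensor B E) where
  inner s t := form B E s t
  conj_inner_symm s t := form_conj_symm B s t
  re_inner_nonneg t := form_self_nonneg B t
  add_left s t u := by simp
  smul_left s t c := by simp

noncomputable instance : SeminormedAddCommGroup (AlgInteriorTensor B E) :=
  InnerProductSpace.Core.toSeminormedAddCommGroup (c := preCore B)
noncomputable instance : InnerProductSpace ℂ (AlgInteriorTensor B E) :=
  InnerProductSpace.ofCore (preCore B)

theorem inner_tmul (x y : E) (h k : H) :
    inner ℂ (tmul B x h) (tmul B y k) = inner ℂ h ((innerMod B x y : H →L[ℂ] H) k) := rfl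

end AlgInteriorTensor

/-- The interior tensor product `E ⊙ H`: the Hilbert space obtained from `E ⊗ H` by dividing out
the vectors of length zero and completing. -/
abbrev InteriorTensor [Module (↥B)ᵐᵒᵖ E] [PreHilbertModule B E] :=
  UniformSpace.Completion (AlgInteriorTensor B E)

variable {E} [Module (↥B)ᵐᵒᵖ E] [PreHilbertModule B E]

/-- The operator `L_x : H → E ⊙ H`, `L_x h = x ⊙ h`. -/
noncomputable def creation (x : E) : H →L[ℂ] InteriorTensor B E :=
  LinearMap.mkContinuous
    { toFun h := ((AlgInteriorTensor.tmul B x h : AlgInteriorTensor B E) : InteriorTensor B E)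
      map_add' h k := by
        rw [← UniformSpace.Completion.coe_add]
        exact congrArg _ (TensorProduct.tmul_add x h k)
      map_smul' c h := by
        rw [RingHom.id_apply, ← UniformSpace.Completion.coe_smul]
        exact congrArg _ (TensorProduct.tmul_smul c x h) }
    (√‖innerMod B x x‖) fun h ↦ by
      change ‖((AlgInteriorTensor.tmul B x h : AlgInteriorTensor B E) : InteriorTensor B E)‖ ≤ _
      rw [UniformSpace.Completion.norm_coe, ← Real.sqrt_sq (norm_nonneg h),
        ← Real.sqrt_mul (norm_nonneg _), norm_eq_sqrt_re_inner (𝕜 := ℂ)]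
      refine Real.sqrt_le_sqrt ((RCLike.re_le_norm _).trans ?_)
      rw [AlgInteriorTensor.inner_tmul]
      refine (norm_inner_le_norm _ _).trans ?_
      have := (innerMod B x x : H →L[ℂ] H).le_opNorm h
      calc ‖h‖ * ‖(innerMod B x x : H →L[ℂ] H) h‖
          ≤ ‖h‖ * (‖(innerMod B x x : H →L[ℂ] H)‖ * ‖h‖) := by gcongr
        _ = ‖innerMod B x x‖ * ‖h‖ ^ 2 := by
            rw [show ‖innerMod B x x‖ = ‖(innerMod B x x : H →L[ℂ] H)‖ from rfl]
            ring

variable (E)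

/-- A pre-Hilbert `B`-module `E` is a von Neumann `B`-module if `{L_x | x ∈ E}` is closed in
`B(H, E ⊙ H)` for the strong operator topology. -/
def IsVonNeumannModule : Prop :=
  IsClosed {T : H →Lₚₜ[ℂ] InteriorTensor B E | ∃ x : E, ∀ h : H, T h = creation B x h}

end InteriorTensor

/-! ### Completely positive maps, `τ`-maps and quasi-representations -/

/-- A linear map `τ : A → B` is completely positive if `∑ i j, b_j* τ(a_j* a_i) b_i ≥ 0` for all
finite families `a_i` in `A` and `b_i` in `B`. -/
def IsCompletelyPositive {A B : Type*} [CStarAlgebra A] [CStarAlgebra B] [PartialOrder B]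
    (τ : A →ₗ[ℂ] B) : Prop :=
  ∀ (n : ℕ) (a : Fin n → A) (b : Fin n → B),
    0 ≤ ∑ i, ∑ j, star (b j) * τ (star (a j) * a i) * b i

/-- `T : E → F` is a `τ`-map if `⟨T x, T y⟩ = τ ⟨x, y⟩`. -/
def IsTauMap {A B E F : Type*} [CStarAlgebra A] [PartialOrder A] [CStarAlgebra B] [PartialOrder B]
    [AddCommGroup E] [Module ℂ E] [Module Aᵐᵒᵖ E] [PreHilbertModule A E]
    [AddCommGroup F] [Module ℂ F] [Module Bᵐᵒᵖ F] [PreHilbertModule B F]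
    (τ : A →ₗ[ℂ] B) (T : E → F) : Prop :=
  ∀ x y : E, innerMod B (T x) (T y) = τ (innerMod A x y)

/-- `Ψ : E → B^a(F, F')` is a quasi-representation with associated representation `π`, that is
`⟨Ψ(y) f₁, Ψ(x) f₂⟩ = ⟨π(⟨x, y⟩) f₁, f₂⟩`. -/
def IsQuasiRepresentation {A B E F F' : Type*} [CStarAlgebra A] [PartialOrder A]
    [CStarAlgebra B] [PartialOrder B]
    [AddCommGroup E] [Module ℂ E] [Module Aᵐᵒᵖ E] [PreHilbertModule A E]
    [AddCommGroup F] [Module ℂ F] [Module Bᵐᵒᵖ F] [PreHilbertModule B F]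
    [AddCommGroup F'] [Module ℂ F'] [Module Bᵐᵒᵖ F'] [PreHilbertModule B F']
    (π : A →⋆ₐ[ℂ] AdjointableMap B F F) (Ψ : E → AdjointableMap B F F') : Prop :=
  ∀ (x y : E) (f₁ f₂ : F),
    innerMod B (Ψ y f₁) (Ψ x f₂) = innerMod B (π (innerMod A x y) f₁) f₂

universe u v w z

/-!
The proof represents von Neumann modules by operators. Let `ρ` be a representation of the commutant
`B'` of `B` on a Hilbert space `K`. The intertwiners, that is the operators `X : H → K` with
`ρ(c) X = X c` for `c ∈ B'`, form a von Neumann `B`-module with `⟨X, Y⟩ = X* Y`, because `X* Y`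
commutes with `B'` and so lies in `B'' = B`. An operator that intertwines two representations of
`B'` acts by left multiplication as an adjointable map between the modules (`compLeft`).

Conversely, a von Neumann module `E` is the module of all intertwiners from `H` to `E ⊙ H`
(`IsVonNeumannModule.exists_unitary`). This is the analytic core. It rests on a density argument
in the style of von Neumann's bicommutant theorem (`exists_creation_tuple_mem_closure`). As a
consequence a bounded operator into `E ⊙ H` that intertwines the actions of `B'` defines an
adjointable map into `E`, and a closed `B'`-invariant subspace of `E ⊙ H` defines a complemented
submodule of `E` (`IsVonNeumannModule.exists_projection`).

The completely positive map `τ` has a Stinespring space `K`, spanned by vectors `L_a h` with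
`L_a* L_a' = τ(a* a')`; it is the reproducing kernel Hilbert space of the kernel `τ(a* a')`. On `K`
act `A`, by `π(a) L_x = L_{a x}`, and `B'`, by `ρ(c) L_x = L_x c`; the two actions commute. The
module `F` consists of the intertwiners for `ρ`, and `V b = L_1 b`. The `τ`-map `T` dilates to
operators `W_x : K → E' ⊙ H`, `L_a h ↦ T(x a) ⊙ h`, with `W_y* W_x = π(⟨x, y⟩)*`. The module `F'`
is the submodule of `E'` that belongs to the closed span of the vectors `T(x) ⊙ h`, the
coisometry `S` is the projection onto it, and `Ψ(x)` is left multiplication by `W_x`.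

All of these operators are prescribed on a total family `L_i h` and are bounded by one criterion
(`IsTotalFamily.exists_clm`).
-/

open ContinuousLinearMap (adjoint adjoint_inner_left adjoint_inner_right)

/-! ### Total families of operators -/

section TotalFamily

variable {ι H K K₂ K₃ : Type*} [NormedAddCommGroup H] [InnerProductSpace ℂ H]
  [NormedAddCommGroup K] [InnerProductSpace ℂ K]
  [NormedAddCommGroup K₂] [InnerProductSpace ℂ K₂]
  [NormedAddCommGroup K₃] [InnerProductSpace ℂ K₃]

/-- The map `(hᵢ)ᵢ ↦ ∑ᵢ Lᵢ hᵢ` on finitely supported families of vectors. -/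
noncomputable def synthesis (L : ι → H →L[ℂ] K) : (ι →₀ H) →ₗ[ℂ] K :=
  Finsupp.lsum ℂ fun i ↦ (L i : H →ₗ[ℂ] K)

/-- A family of operators `Lᵢ : H → K` is total if the vectors `Lᵢ h` span a dense subspace
of `K`. -/
def IsTotalFamily (L : ι → H →L[ℂ] K) : Prop := DenseRange (synthesis L)

theorem synthesis_apply (L : ι → H →L[ℂ] K) (v : ι →₀ H) :
    synthesis L v = v.sum fun i h ↦ L i h := rfl

@[simp]
theorem synthesis_single (L : ι → H →L[ℂ] K) (i : ι) (h : H) :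
    synthesis L (Finsupp.single i h) = L i h := by
  simp [synthesis_apply]

theorem isTotalFamily_of_dense_span {L : ι → H →L[ℂ] K} {s : Set K}
    (hs : Dense (Submodule.span ℂ s : Set K)) (h : ∀ x ∈ s, ∃ i k, L i k = x) : IsTotalFamily L := by
  have : Submodule.span ℂ s ≤ LinearMap.range (synthesis L) :=
    Submodule.span_le.2 fun x hx ↦ by
      obtain ⟨i, k, rfl⟩ := h x hx
      exact ⟨Finsupp.single i k, synthesis_single L i k⟩
  exact hs.mono this

theorem IsTotalFamily.ext_clm {L : ι → H →L[ℂ] K} (hL : IsTotalFamily L) {D D' : K →L[ℂ] K₂}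
    (h : ∀ i, D ∘L L i = D' ∘L L i) : D = D' := by
  refine ContinuousLinearMap.coeFn_injective (hL.equalizer D.continuous D'.continuous ?_)
  funext v
  simp only [Function.comp_apply, synthesis_apply, Finsupp.sum, map_sum]
  exact Finset.sum_congr rfl fun i _ ↦ DFunLike.congr_fun (h i) _

theorem IsTotalFamily.eq_zero_of_inner {L : ι → H →L[ℂ] K} (hL : IsTotalFamily L) {k : K}
    (h : ∀ i x, inner ℂ (L i x) k = 0) : k = 0 := by
  refine hL.eq_zero_of_inner_right ℂ fun v ↦ ?_
  rw [synthesis_apply, Finsupp.sum, sum_inner]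
  exact Finset.sum_eq_zero fun i _ ↦ h i _

variable [CompleteSpace H] [CompleteSpace K]

theorem IsTotalFamily.eq_of_adjoint_comp {G : Type*} [NormedAddCommGroup G] [InnerProductSpace ℂ G]
    {L : ι → H →L[ℂ] K} (hL : IsTotalFamily L)
    {X Y : G →L[ℂ] K} (h : ∀ i, adjoint (L i) ∘L X = adjoint (L i) ∘L Y) : X = Y := by
  ext g
  rw [← sub_eq_zero]
  refine hL.eq_zero_of_inner fun i x ↦ ?_
  rw [← adjoint_inner_right, map_sub]
  have := DFunLike.congr_fun (h i) g
  simp only [ContinuousLinearMap.comp_apply] at this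
  rw [this, sub_self, inner_zero_right]

theorem IsTotalFamily.eq_of_adjoint_comp_comp {κ : Type*} {L : κ → H →L[ℂ] K₂} (hL : IsTotalFamily L)
    {M : ι → H →L[ℂ] K} (hM : IsTotalFamily M)
    {D D' : K₂ →L[ℂ] K} (h : ∀ i j, adjoint (M i) ∘L D ∘L L j = adjoint (M i) ∘L D' ∘L L j) :
    D = D' :=
  hL.ext_clm fun j ↦ hM.eq_of_adjoint_comp fun i ↦ h i j

theorem norm_sq_synthesis (L : ι → H →L[ℂ] K) (v : ι →₀ H) :
    ((‖synthesis L v‖ ^ 2 : ℝ) : ℂ) =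
      v.sum fun i h ↦ v.sum fun j k ↦ inner ℂ h ((adjoint (L i) ∘L L j) k) := by
  push_cast
  refine (inner_self_eq_norm_sq_to_K (𝕜 := ℂ) (synthesis L v)).symm.trans ?_
  rw [synthesis_apply, Finsupp.sum, sum_inner]
  refine Finset.sum_congr rfl fun i _ ↦ ?_
  rw [inner_sum]
  exact Finset.sum_congr rfl fun j _ ↦ (adjoint_inner_right (L i) (v i) (L j (v j))).symm

variable [CompleteSpace K₂] [CompleteSpace K₃]

/-- If the Gram operators satisfy `Mᵢ* Mⱼ + Nᵢ* Nⱼ = r Lᵢ* Lⱼ`, then `Lᵢ h ↦ Mᵢ h` extends to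
a bounded operator. The family `N` witnesses the inequality `‖∑ Mᵢ hᵢ‖² ≤ r ‖∑ Lᵢ hᵢ‖²`. -/
theorem IsTotalFamily.exists_clm {L : ι → H →L[ℂ] K} (hL : IsTotalFamily L) (M : ι → H →L[ℂ] K₂)
    (N : ι → H →L[ℂ] K₃) (r : ℝ)
    (h : ∀ i j, adjoint (M i) ∘L M j + adjoint (N i) ∘L N j = (r : ℂ) • (adjoint (L i) ∘L L j)) :
    ∃ D : K →L[ℂ] K₂, ∀ i, D ∘L L i = M i := by
  have hsq (v : ι →₀ H) :
      ‖synthesis M v‖ ^ 2 + ‖synthesis N v‖ ^ 2 = r * ‖synthesis L v‖ ^ 2 := by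
    have : ((‖synthesis M v‖ ^ 2 : ℝ) : ℂ) + ((‖synthesis N v‖ ^ 2 : ℝ) : ℂ) =
        (r : ℂ) * ((‖synthesis L v‖ ^ 2 : ℝ) : ℂ) := by
      rw [norm_sq_synthesis, norm_sq_synthesis, norm_sq_synthesis]
      simp only [Finsupp.sum, Finset.mul_sum, ← Finset.sum_add_distrib]
      refine Finset.sum_congr rfl fun i _ ↦ Finset.sum_congr rfl fun j _ ↦ ?_
      rw [← inner_add_right, ← add_apply, h, smul_apply,
        inner_smul_right]
    exact_mod_cast this
  have hb : ∃ C, ∀ v, ‖synthesis M v‖ ≤ C * ‖synthesis L v‖ := by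
    refine ⟨√(max r 0), fun v ↦ ?_⟩
    rw [← Real.sqrt_sq (norm_nonneg (synthesis M v)), ← Real.sqrt_sq (norm_nonneg (synthesis L v)),
      ← Real.sqrt_mul (le_max_right _ _)]
    refine Real.sqrt_le_sqrt ?_
    calc ‖synthesis M v‖ ^ 2 ≤ r * ‖synthesis L v‖ ^ 2 := by
          rw [← hsq]
          exact le_add_of_nonneg_right (sq_nonneg _)
      _ ≤ max r 0 * ‖synthesis L v‖ ^ 2 := by gcongr; exact le_max_left _ _
  refine ⟨(synthesis M).extendOfNorm (synthesis L), fun i ↦ ?_⟩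
  ext x
  have := LinearMap.extendOfNorm_eq hL hb (Finsupp.single i x)
  rwa [synthesis_single, synthesis_single] at this

end TotalFamily

/-! ### The representation of the commutant -/

section Commutant

variable {H K : Type*} [NormedAddCommGroup H] [InnerProductSpace ℂ H] [CompleteSpace H]
  [NormedAddCommGroup K] [InnerProductSpace ℂ K] [CompleteSpace K]

theorem VonNeumannAlgebra.mem_iff_comm {B : VonNeumannAlgebra H} {x : H →L[ℂ] H} :
    x ∈ B ↔ ∀ c : B.commutant, (c : H →L[ℂ] H) ∘L x = x ∘L (c : H →L[ℂ] H) := by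
  conv_lhs => rw [← B.commutant_commutant, VonNeumannAlgebra.mem_commutant_iff]
  exact ⟨fun h c ↦ h c c.2, fun h c hc ↦ h ⟨c, hc⟩⟩

theorem VonNeumannAlgebra.commutant_comp_comm {B : VonNeumannAlgebra H} (c : B.commutant)
    {x : H →L[ℂ] H} (hx : x ∈ B) : (c : H →L[ℂ] H) ∘L x = x ∘L (c : H →L[ℂ] H) :=
  VonNeumannAlgebra.mem_iff_comm.1 hx c

/-- The inequality `a ≤ ‖a‖` for positive `a`, in the form in which it feeds
`IsTotalFamily.exists_clm`. -/
theorem exists_add_star_mul_self_eq {C : Type*} [CStarAlgebra C] [PartialOrder C]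
    [StarOrderedRing C] {a : C} (ha : 0 ≤ a) :
    ∃ d : C, a + star d * d = (‖a‖ : ℂ) • 1 := by
  have h : 0 ≤ algebraMap ℝ C ‖a‖ - a :=
    sub_nonneg.2 (IsSelfAdjoint.le_algebraMap_norm_self ha.isSelfAdjoint)
  obtain ⟨d, hd⟩ := CStarAlgebra.nonneg_iff_eq_star_mul_self.1 h
  refine ⟨d, ?_⟩
  rw [← hd, add_sub_cancel, Algebra.algebraMap_eq_smul_one, Complex.coe_smul]

/-- If `L` is a total family with `Lᵢ* Lⱼ ∈ B`, then the commutant of `B` acts on `K` by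
`c ↦ (Lᵢ h ↦ Lᵢ c h)`. -/
theorem IsTotalFamily.exists_commutantRep {ι : Type*} {L : ι → H →L[ℂ] K} (hL : IsTotalFamily L)
    (B : VonNeumannAlgebra H) (hB : ∀ i j, adjoint (L i) ∘L L j ∈ B) :
    ∃ ρ : B.commutant →⋆ₐ[ℂ] (K →L[ℂ] K), ∀ c i, ρ c ∘L L i = L i ∘L (c : H →L[ℂ] H) := by
  have hex (c : B.commutant) : ∃ D : K →L[ℂ] K, ∀ i, D ∘L L i = L i ∘L (c : H →L[ℂ] H) := by
    obtain ⟨d, hd⟩ := exists_add_star_mul_self_eq (star_mul_self_nonneg c)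
    refine hL.exists_clm _ (fun i ↦ L i ∘L (d : H →L[ℂ] H)) ‖star c * c‖ fun i j ↦ ?_
    have key (c : B.commutant) : adjoint (L i ∘L (c : H →L[ℂ] H)) ∘L L j ∘L (c : H →L[ℂ] H) =
        (adjoint (L i) ∘L L j) ∘L ((star c * c : B.commutant) : H →L[ℂ] H) := by
      rw [ContinuousLinearMap.adjoint_comp]
      exact congrArg (· ∘L (c : H →L[ℂ] H))
        (VonNeumannAlgebra.commutant_comp_comm (star c) (hB i j))
    rw [key, key, ← ContinuousLinearMap.comp_add]
    have := congrArg (fun x : B.commutant ↦ (x : H →L[ℂ] H)) hd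
    change ((star c * c : B.commutant) : H →L[ℂ] H) + ((star d * d : B.commutant) : H →L[ℂ] H) =
      ((‖star c * c‖ : ℝ) : ℂ) • (1 : H →L[ℂ] H) at this
    rw [this, ContinuousLinearMap.comp_smul]
    rfl
  choose D hD using hex
  have hD' (c : B.commutant) (i : ι) (x : H) : D c (L i x) = L i ((c : H →L[ℂ] H) x) :=
    DFunLike.congr_fun (hD c i) x
  refine ⟨{ toFun := D
            map_one' := hL.ext_clm fun i ↦ by ext x; exact hD' 1 i x
            map_mul' := fun c d ↦ hL.ext_clm fun i ↦ by
              ext x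
              change D (c * d) (L i x) = D c (D d (L i x))
              rw [hD', hD', hD']; rfl
            map_zero' := hL.ext_clm fun i ↦ by
              ext x
              exact (hD' 0 i x).trans (map_zero _)
            map_add' := fun c d ↦ hL.ext_clm fun i ↦ by
              ext x
              change D (c + d) (L i x) = D c (L i x) + D d (L i x)
              rw [hD', hD', hD', ← map_add]; rfl
            commutes' := fun r ↦ hL.ext_clm fun i ↦ by
              ext x
              exact (hD' _ i x).trans (map_smul (L i) r x)
            map_star' := fun c ↦ hL.eq_of_adjoint_comp_comp hL fun i j ↦ ?_ }, hD⟩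
  change _ = adjoint (L i) ∘L adjoint (D c) ∘L L j
  rw [hD, ← ContinuousLinearMap.comp_assoc, ← ContinuousLinearMap.comp_assoc,
    ← ContinuousLinearMap.adjoint_comp, hD, ContinuousLinearMap.adjoint_comp]
  exact (VonNeumannAlgebra.commutant_comp_comm (star c) (hB i j)).symm

end Commutant

/-! ### Creation operators and strong density -/

section Creation

open PreHilbertModule

variable {H : Type*} [NormedAddCommGroup H] [InnerProductSpace ℂ H] [CompleteSpace H]
  (B : VonNeumannAlgebra H) {E : Type*} [AddCommGroup E] [Module ℂ E] [Module (↥B)ᵐᵒᵖ E]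
  [PreHilbertModule B E]

theorem inner_creation (x y : E) (h k : H) :
    inner ℂ (creation B x h) (creation B y k) = inner ℂ h ((innerMod B x y : H →L[ℂ] H) k) :=
  (UniformSpace.Completion.inner_coe _ _).trans (AlgInteriorTensor.inner_tmul B x y h k)

theorem adjoint_creation_comp_creation (x y : E) :
    adjoint (creation B x) ∘L creation B y = (innerMod B x y : H →L[ℂ] H) := by
  ext h
  refine ext_inner_left ℂ fun k ↦ ?_
  rw [ContinuousLinearMap.comp_apply, adjoint_inner_right, inner_creation]

theorem adjoint_creation_comp_creation_mem (x y : E) :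
    adjoint (creation B x) ∘L creation B y ∈ B := by
  rw [adjoint_creation_comp_creation]
  exact (innerMod B x y).2

theorem isTotalFamily_creation : IsTotalFamily (fun x : E ↦ creation B x) := by
  refine Dense.mono ?_ UniformSpace.Completion.denseRange_coe
  rintro _ ⟨t, rfl⟩
  obtain ⟨n, x, h, rfl⟩ := AlgInteriorTensor.exists_sum B t
  refine ⟨∑ i, Finsupp.single (x i) (h i), ?_⟩
  rw [map_sum]
  simp only [synthesis_single]
  exact (map_sum (UniformSpace.Completion.toComplL (𝕜 := ℂ) (E := AlgInteriorTensor B E)) _ _).symm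

theorem creation_add (x y : E) : creation B (x + y) = creation B x + creation B y :=
  (isTotalFamily_creation B).eq_of_adjoint_comp fun z ↦ by
    simp only [ContinuousLinearMap.comp_add, adjoint_creation_comp_creation, innerMod_add_right]
    rfl

theorem creation_smul (c : ℂ) (x : E) : creation B (c • x) = c • creation B x :=
  (isTotalFamily_creation B).eq_of_adjoint_comp fun z ↦ by
    simp only [ContinuousLinearMap.comp_smul, adjoint_creation_comp_creation, innerMod_smul_right]
    rfl

theorem creation_op_smul (b : B) (x : E) :
    creation B (MulOpposite.op b • x) = creation B x ∘L (b : H →L[ℂ] H) :=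
  (isTotalFamily_creation B).eq_of_adjoint_comp fun z ↦ by
    rw [← ContinuousLinearMap.comp_assoc, adjoint_creation_comp_creation,
      adjoint_creation_comp_creation, innerMod_op_smul_right]
    rfl

theorem creation_injective : Function.Injective (fun x : E ↦ creation B x) := fun x y h ↦
  ext_innerMod (A := B) fun z ↦ Subtype.ext <| by
    rw [← adjoint_creation_comp_creation, ← adjoint_creation_comp_creation]
    exact congrArg _ h

variable {B}

/-- Density theorem: an operator `X : H → E ⊙ H` with `L_y* X ∈ B` for all `y` can be approximated
on finitely many vectors `hᵢ` by creation operators. With `M` the closure of `{(b hᵢ)ᵢ | b ∈ B}` and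
`N` the closure of `{(L_y hᵢ)ᵢ | y ∈ E}`, the component `η` of `(X hᵢ)ᵢ` orthogonal to `N` satisfies
`L_y* η ∈ M` and `L_y* η ⊥ M`; hence `L_y* η = 0` for all `y`, and `η = 0`. -/
theorem exists_creation_tuple_mem_closure {s : Type*} [Fintype s]
    {X : H →L[ℂ] InteriorTensor B E} (hX : ∀ y : E, adjoint (creation B y) ∘L X ∈ B) (h : s → H) :
    WithLp.toLp 2 (fun i ↦ X (h i)) ∈
      closure (Set.range fun y : E ↦ WithLp.toLp 2 fun i ↦ creation B y (h i)) := by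
  let M : Submodule ℂ (PiLp 2 fun _ : s ↦ H) :=
    (LinearMap.range
      ({ toFun := fun b ↦ WithLp.toLp 2 fun i ↦ (b : H →L[ℂ] H) (h i)
         map_add' := fun _ _ ↦ rfl
         map_smul' := fun _ _ ↦ rfl } : B →ₗ[ℂ] PiLp 2 fun _ : s ↦ H)).topologicalClosure
  let N₀ : Submodule ℂ (PiLp 2 fun _ : s ↦ InteriorTensor B E) :=
    LinearMap.range
      ({ toFun := fun y ↦ WithLp.toLp 2 fun i ↦ creation B y (h i)
         map_add' := fun x y ↦ by
           simp only [creation_add]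
           rfl
         map_smul' := fun c x ↦ by
           simp only [creation_smul]
           rfl } : E →ₗ[ℂ] PiLp 2 fun _ : s ↦ InteriorTensor B E)
  let N := N₀.topologicalClosure
  let ξ : PiLp 2 fun _ : s ↦ InteriorTensor B E := WithLp.toLp 2 fun i ↦ X (h i)
  change ξ ∈ N
  -- `L_y` maps `M` to `N`, and `L_y*` maps `N` to `M`
  have hMN (y : E) (m : PiLp 2 fun _ : s ↦ H) (hm : m ∈ M) :
      WithLp.toLp 2 (fun i ↦ creation B y (m i)) ∈ N := by
    refine map_mem_closure (f := fun m : PiLp 2 fun _ : s ↦ H ↦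
      (WithLp.toLp 2 fun i ↦ creation B y (m i) : PiLp 2 fun _ : s ↦ InteriorTensor B E))
      (by fun_prop) hm ?_
    rintro _ ⟨b, rfl⟩
    refine ⟨MulOpposite.op b • y, ?_⟩
    change WithLp.toLp 2 (fun i ↦ creation B (MulOpposite.op b • y) (h i)) = _
    simp only [creation_op_smul]
    rfl
  have hNM (y : E) (n : PiLp 2 fun _ : s ↦ InteriorTensor B E) (hn : n ∈ N) :
      WithLp.toLp 2 (fun i ↦ adjoint (creation B y) (n i)) ∈ M := by
    refine map_mem_closure (f := fun n : PiLp 2 fun _ : s ↦ InteriorTensor B E ↦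
      (WithLp.toLp 2 fun i ↦ adjoint (creation B y) (n i) : PiLp 2 fun _ : s ↦ H))
      (by fun_prop) hn ?_
    rintro _ ⟨x, rfl⟩
    refine ⟨innerMod B y x, ?_⟩
    change WithLp.toLp 2 (fun i ↦ (innerMod B y x : H →L[ℂ] H) (h i)) = _
    simp only [← adjoint_creation_comp_creation]
    rfl
  -- the component `η` of `ξ` orthogonal to `N` satisfies `L_y* η ∈ M ⊓ Mᗮ`
  have hη : ξ - N.starProjection ξ ∈ Nᗮ := N.sub_starProjection_mem_orthogonal ξ
  set η := ξ - N.starProjection ξ with hη_def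
  have hmem (y : E) : WithLp.toLp 2 (fun i ↦ adjoint (creation B y) (η i)) ∈ M := by
    have h1 : WithLp.toLp 2 (fun i ↦ adjoint (creation B y) (ξ i)) ∈ M :=
      Submodule.le_topologicalClosure _ ⟨⟨_, hX y⟩, rfl⟩
    have h2 := hNM y _ (N.starProjection_apply_mem ξ)
    convert! M.sub_mem h1 h2 using 1
    ext i
    exact map_sub _ _ _
  have hzero (y : E) : WithLp.toLp 2 (fun i ↦ adjoint (creation B y) (η i)) = 0 := by
    rw [← inner_self_eq_zero (𝕜 := ℂ)]
    have := (Submodule.mem_orthogonal _ _).1 hη _ (hMN y _ (hmem y))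
    rw [PiLp.inner_apply] at this ⊢
    simpa only [adjoint_inner_right] using this
  have : η = 0 := by
    ext i
    refine (isTotalFamily_creation B).eq_zero_of_inner fun y x ↦ ?_
    rw [← adjoint_inner_right]
    have := congrArg (fun m : PiLp 2 fun _ : s ↦ H ↦ m i) (hzero y)
    simp only [PiLp.zero_apply] at this
    rw [this, inner_zero_right]
  rw [hη_def, sub_eq_zero] at this
  rw [this]
  exact N.starProjection_apply_mem ξ

/-- In a von Neumann module, every operator `X : H → E ⊙ H` with `L_y* X ∈ B` for all `y` is a
creation operator. -/
theorem IsVonNeumannModule.exists_creation_eq (hE : IsVonNeumannModule B E)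
    {X : H →L[ℂ] InteriorTensor B E} (hX : ∀ y : E, adjoint (creation B y) ∘L X ∈ B) :
    ∃ x : E, creation B x = X := by
  let X' : H →Lₚₜ[ℂ] InteriorTensor B E :=
    ContinuousLinearMap.toPointwiseConvergenceCLM ℂ (RingHom.id ℂ) H (InteriorTensor B E) X
  have hX' (h : H) : X' h = X h := rfl
  suffices X' ∈ {T : H →Lₚₜ[ℂ] InteriorTensor B E | ∃ x : E, ∀ h : H, T h = creation B x h} by
    obtain ⟨x, hx⟩ := this
    exact ⟨x, ContinuousLinearMap.ext fun h ↦ (hx h).symm.trans (hX' h)⟩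
  rw [← IsClosed.closure_eq hE,
    (PointwiseConvergenceCLM.isEmbedding_coeFn _ _ _).closure_eq_preimage_closure_image,
    Set.mem_preimage, mem_closure_iff_nhds]
  intro U hU
  rw [nhds_pi, Filter.mem_pi] at hU
  obtain ⟨I, hI, t, ht, hIt⟩ := hU
  have := hI.fintype
  have hnhds : {n : PiLp 2 fun _ : I ↦ InteriorTensor B E | ∀ i : I, n i ∈ t i} ∈
      nhds (WithLp.toLp 2 fun i : I ↦ X i) := by
    refine Filter.eventually_all.2 fun i ↦ ?_
    have : Continuous fun n : PiLp 2 fun _ : I ↦ InteriorTensor B E ↦ n i := by fun_prop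
    exact this.continuousAt (ht i)
  obtain ⟨_, hn, x, rfl⟩ := mem_closure_iff_nhds.1
    (exists_creation_tuple_mem_closure hX fun i : I ↦ (i : H)) _ hnhds
  exact ⟨fun h ↦ creation B x h, hIt fun i hi ↦ hn ⟨i, hi⟩,
    ContinuousLinearMap.toPointwiseConvergenceCLM ℂ (RingHom.id ℂ) H (InteriorTensor B E)
      (creation B x), ⟨x, fun _ ↦ rfl⟩, rfl⟩

end Creation

/-! ### Modules of intertwiners -/

/-- If the Gram operators of `L` and `M` agree, then `Lᵢ h ↦ Mᵢ h` extends to an isometry. -/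
theorem IsTotalFamily.exists_injective_clm {ι H K K₂ : Type*} [NormedAddCommGroup H]
    [InnerProductSpace ℂ H] [CompleteSpace H]
    [NormedAddCommGroup K] [InnerProductSpace ℂ K] [CompleteSpace K]
    [NormedAddCommGroup K₂] [InnerProductSpace ℂ K₂] [CompleteSpace K₂]
    {L : ι → H →L[ℂ] K} (hL : IsTotalFamily L) (M : ι → H →L[ℂ] K₂)
    (h : ∀ i j, adjoint (M i) ∘L M j = adjoint (L i) ∘L L j) :
    ∃ U : K →L[ℂ] K₂, (∀ i, U ∘L L i = M i) ∧ Function.Injective U := by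
  obtain ⟨U, hU⟩ := hL.exists_clm M (fun _ ↦ (0 : H →L[ℂ] K₂)) 1 fun i j ↦ by simp [h]
  have hUU : adjoint U ∘L U = ContinuousLinearMap.id ℂ K :=
    hL.eq_of_adjoint_comp_comp hL fun i j ↦ by
      rw [ContinuousLinearMap.id_comp, ContinuousLinearMap.comp_assoc, hU,
        ← ContinuousLinearMap.comp_assoc, ← ContinuousLinearMap.adjoint_comp, hU, h]
  exact ⟨U, hU, Function.LeftInverse.injective (g := adjoint U) fun x ↦ DFunLike.congr_fun hUU x⟩

section Intertwiners

open PreHilbertModule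

variable {H K K₂ : Type*} [NormedAddCommGroup H] [InnerProductSpace ℂ H] [CompleteSpace H]
  [NormedAddCommGroup K] [InnerProductSpace ℂ K] [CompleteSpace K]
  [NormedAddCommGroup K₂] [InnerProductSpace ℂ K₂] [CompleteSpace K₂]
  {B : VonNeumannAlgebra H}

/-- The operators `X : H → K` with `ρ(c) X = X c` for all `c` in the commutant of `B`, where `ρ` is
a representation of the commutant on `K`. -/
def intertwiners (ρ : B.commutant →⋆ₐ[ℂ] (K →L[ℂ] K)) : Submodule ℂ (H →L[ℂ] K) where
  carrier := {X | ∀ c : B.commutant, ρ c ∘L X = X ∘L (c : H →L[ℂ] H)}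
  add_mem' hX hY c := by
    rw [ContinuousLinearMap.comp_add, hX c, hY c, ContinuousLinearMap.add_comp]
  zero_mem' c := by simp
  smul_mem' r X hX c := by
    rw [ContinuousLinearMap.comp_smul, hX c, ContinuousLinearMap.smul_comp]

variable {ρ : B.commutant →⋆ₐ[ℂ] (K →L[ℂ] K)} {ρ₂ : B.commutant →⋆ₐ[ℂ] (K₂ →L[ℂ] K₂)}

theorem adjoint_comp_rep {X : H →L[ℂ] K} (hX : X ∈ intertwiners ρ) (c : B.commutant) :
    adjoint X ∘L ρ c = (c : H →L[ℂ] H) ∘L adjoint X := by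
  have h := congrArg adjoint (hX (star c))
  rw [ContinuousLinearMap.adjoint_comp, ContinuousLinearMap.adjoint_comp, map_star] at h
  change adjoint X ∘L star (star (ρ c)) = star (star (c : H →L[ℂ] H)) ∘L adjoint X at h
  rwa [star_star, star_star] at h

theorem adjoint_comp_mem {X Y : H →L[ℂ] K} (hX : X ∈ intertwiners ρ) (hY : Y ∈ intertwiners ρ) :
    adjoint X ∘L Y ∈ B := by
  refine VonNeumannAlgebra.mem_iff_comm.2 fun c ↦ ?_
  rw [← ContinuousLinearMap.comp_assoc, ← adjoint_comp_rep hX, ContinuousLinearMap.comp_assoc,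
    hY c, ContinuousLinearMap.comp_assoc]

theorem comp_mem_intertwiners {X : H →L[ℂ] K} (hX : X ∈ intertwiners ρ) {b : H →L[ℂ] H}
    (hb : b ∈ B) : X ∘L b ∈ intertwiners ρ := fun c ↦ by
  rw [← ContinuousLinearMap.comp_assoc, hX c, ContinuousLinearMap.comp_assoc,
    VonNeumannAlgebra.commutant_comp_comm c hb, ContinuousLinearMap.comp_assoc]

instance : SMul (↥B)ᵐᵒᵖ (intertwiners ρ) where
  smul b X := ⟨(X : H →L[ℂ] K) ∘L (b.unop : H →L[ℂ] H), comp_mem_intertwiners X.2 b.unop.2⟩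

/-- `B` acts on the intertwiners from the right, by composition. -/
instance : Module (↥B)ᵐᵒᵖ (intertwiners ρ) where
  one_smul _ := rfl
  mul_smul _ _ _ := rfl
  smul_zero _ := Subtype.ext (ContinuousLinearMap.zero_comp _)
  smul_add _ _ _ := Subtype.ext (ContinuousLinearMap.add_comp _ _ _)
  add_smul _ _ _ := Subtype.ext (ContinuousLinearMap.comp_add _ _ _)
  zero_smul _ := Subtype.ext (ContinuousLinearMap.comp_zero _)

/-- The intertwiners form a pre-Hilbert `B`-module with `⟨X, Y⟩ = X* Y`. -/
noncomputable instance : PreHilbertModule B (intertwiners ρ) where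
  innerProd X Y := ⟨adjoint (X : H →L[ℂ] K) ∘L (Y : H →L[ℂ] K), adjoint_comp_mem X.2 Y.2⟩
  smul_op_smul c X b := Subtype.ext (ContinuousLinearMap.smul_comp _ _ _).symm
  op_smul_smul c X b := Subtype.ext <| by
    change (c • (X : H →L[ℂ] K)) ∘L (b : H →L[ℂ] H) = (X : H →L[ℂ] K) ∘L (c • (b : H →L[ℂ] H))
    rw [ContinuousLinearMap.smul_comp, ContinuousLinearMap.comp_smul]
  innerProd_self_nonneg X := by
    change (0 : H →L[ℂ] H) ≤ adjoint (X : H →L[ℂ] K) ∘L (X : H →L[ℂ] K)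
    exact (ContinuousLinearMap.nonneg_iff_isPositive _).2
      (ContinuousLinearMap.isPositive_adjoint_comp_self _)
  eq_zero_of_innerProd_self X h := by
    have h' : adjoint (X : H →L[ℂ] K) ∘L (X : H →L[ℂ] K) = 0 := congrArg Subtype.val h
    refine Subtype.ext (ContinuousLinearMap.ext fun x ↦ ?_)
    change (X : H →L[ℂ] K) x = 0
    rw [← inner_self_eq_zero (𝕜 := ℂ), ← adjoint_inner_right, ← ContinuousLinearMap.comp_apply, h']
    simp
  innerProd_op_smul _ _ _ := rfl
  star_innerProd X Y := Subtype.ext <| by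
    change adjoint (adjoint (Y : H →L[ℂ] K) ∘L (X : H →L[ℂ] K)) =
      adjoint (X : H →L[ℂ] K) ∘L (Y : H →L[ℂ] K)
    rw [ContinuousLinearMap.adjoint_comp, ContinuousLinearMap.adjoint_adjoint]
  innerProd_add _ _ _ := Subtype.ext (ContinuousLinearMap.comp_add _ _ _)
  innerProd_smul _ _ _ := Subtype.ext (ContinuousLinearMap.comp_smul _ _ _)

theorem coe_innerMod_intertwiners (X Y : intertwiners ρ) :
    (innerMod B X Y : H →L[ℂ] H) = adjoint (X : H →L[ℂ] K) ∘L (Y : H →L[ℂ] K) := rfl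

/-- The map `X ⊙ h ↦ X h` identifies `F ⊙ H` with a subspace of `K`, and in `K` the
intertwining relation is preserved by strong limits. -/
theorem isVonNeumannModule_intertwiners (ρ : B.commutant →⋆ₐ[ℂ] (K →L[ℂ] K)) :
    IsVonNeumannModule B (intertwiners ρ) := by
  obtain ⟨U, hU, hinj⟩ := (isTotalFamily_creation B (E := intertwiners ρ)).exists_injective_clm
    (fun X ↦ (X : H →L[ℂ] K)) fun X Y ↦ by
      rw [adjoint_creation_comp_creation, coe_innerMod_intertwiners]
  have hU' (X : intertwiners ρ) (h : H) : U (creation B X h) = (X : H →L[ℂ] K) h :=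
    DFunLike.congr_fun (hU X) h
  have : {T : H →Lₚₜ[ℂ] InteriorTensor B (intertwiners ρ) |
      ∃ x, ∀ h : H, T h = creation B x h} =
      ⋂ (c : B.commutant) (h : H), {T | ρ c (U (T h)) = U (T ((c : H →L[ℂ] H) h))} := by
    ext T
    simp only [Set.mem_iInter, Set.mem_ofPred_eq]
    constructor
    · rintro ⟨X, hX⟩ c h
      rw [hX, hX, hU', hU']
      exact DFunLike.congr_fun (X.2 c) h
    · intro hT
      let T' : H →L[ℂ] InteriorTensor B (intertwiners ρ) := T
      refine ⟨⟨U ∘L T', fun c ↦ ContinuousLinearMap.ext fun h ↦ hT c h⟩, fun h ↦ hinj ?_⟩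
      rw [hU']
      rfl
  rw [IsVonNeumannModule, this]
  refine isClosed_iInter fun c ↦ isClosed_iInter fun h ↦ isClosed_eq ?_ ?_
  · exact (ρ c).continuous.comp (U.continuous.comp (continuous_eval_const h))
  · exact U.continuous.comp (continuous_eval_const _)

/-- Composition with an operator `D : K → K₂` that intertwines two representations of the
commutant, as an adjointable map between the modules of intertwiners. -/
noncomputable def compLeft (D : K →L[ℂ] K₂) (hD : ∀ c, ρ₂ c ∘L D = D ∘L ρ c) :
    AdjointableMap B (intertwiners ρ) (intertwiners ρ₂) where
  toFun X := ⟨D ∘L (X : H →L[ℂ] K), fun c ↦ by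
    rw [← ContinuousLinearMap.comp_assoc, hD, ContinuousLinearMap.comp_assoc, X.2 c,
      ContinuousLinearMap.comp_assoc]⟩
  adjFun Y := ⟨adjoint D ∘L (Y : H →L[ℂ] K₂), fun c ↦ by
    have h := congrArg adjoint (hD (star c))
    rw [ContinuousLinearMap.adjoint_comp, ContinuousLinearMap.adjoint_comp, map_star ρ,
      map_star ρ₂] at h
    change adjoint D ∘L star (star (ρ₂ c)) = star (star (ρ c)) ∘L adjoint D at h
    rw [star_star, star_star] at h
    rw [← ContinuousLinearMap.comp_assoc, ← h, ContinuousLinearMap.comp_assoc, Y.2 c,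
      ContinuousLinearMap.comp_assoc]⟩
  inner_toFun_left X Y := Subtype.ext <| by
    change adjoint (D ∘L (X : H →L[ℂ] K)) ∘L (Y : H →L[ℂ] K₂) =
      adjoint (X : H →L[ℂ] K) ∘L adjoint D ∘L (Y : H →L[ℂ] K₂)
    rw [ContinuousLinearMap.adjoint_comp, ContinuousLinearMap.comp_assoc]

theorem coe_compLeft (D : K →L[ℂ] K₂) (hD : ∀ c, ρ₂ c ∘L D = D ∘L ρ c) (X : intertwiners ρ) :
    (compLeft D hD X : H →L[ℂ] K₂) = D ∘L (X : H →L[ℂ] K) := rfl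

/-- A representation on `K` that commutes with `ρ` acts on the intertwiners by left
multiplication. -/
noncomputable def compLeftRep {A : Type*} [CStarAlgebra A] (π : A →⋆ₐ[ℂ] (K →L[ℂ] K))
    (hπ : ∀ a c, ρ c ∘L π a = π a ∘L ρ c) :
    A →⋆ₐ[ℂ] AdjointableMap B (intertwiners ρ) (intertwiners ρ) where
  toFun a := compLeft (π a) (hπ a)
  map_one' := AdjointableMap.ext fun X ↦ Subtype.ext <| by
    rw [coe_compLeft, map_one]
    rfl
  map_mul' a b := AdjointableMap.ext fun X ↦ Subtype.ext <| by
    rw [coe_compLeft, map_mul]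
    rfl
  map_zero' := AdjointableMap.ext fun X ↦ Subtype.ext <| by
    rw [coe_compLeft, map_zero]
    exact ContinuousLinearMap.zero_comp _
  map_add' a b := AdjointableMap.ext fun X ↦ Subtype.ext <| by
    rw [coe_compLeft, map_add]
    exact ContinuousLinearMap.add_comp _ _ _
  commutes' r := AdjointableMap.ext fun X ↦ Subtype.ext <| by
    rw [coe_compLeft, AlgHomClass.commutes, Algebra.algebraMap_eq_smul_one]
    rfl
  map_star' a := AdjointableMap.ext fun X ↦ Subtype.ext <| by
    rw [coe_compLeft, map_star]
    rfl

theorem coe_compLeftRep {A : Type*} [CStarAlgebra A] (π : A →⋆ₐ[ℂ] (K →L[ℂ] K))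
    (hπ : ∀ a c, ρ c ∘L π a = π a ∘L ρ c) (a : A) (X : intertwiners ρ) :
    (compLeftRep π hπ a X : H →L[ℂ] K) = π a ∘L (X : H →L[ℂ] K) := rfl

/-- An element `x` of a pre-Hilbert `B`-module `F` as the adjointable map `b ↦ x b` from `B`
to `F`; its adjoint is `y ↦ ⟨x, y⟩`. -/
def AdjointableMap.ofElement {C F : Type*} [CStarAlgebra C] [PartialOrder C] [StarOrderedRing C]
    [AddCommGroup F] [Module ℂ F] [Module Cᵐᵒᵖ F] [PreHilbertModule C F] (x : F) :
    AdjointableMap C C F where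
  toFun b := MulOpposite.op b • x
  adjFun y := innerMod C x y
  inner_toFun_left b y := innerMod_op_smul_left x y b

end Intertwiners

/-! ### Complemented submodules of a von Neumann module -/

section Submodules

open PreHilbertModule

variable {H : Type*} [NormedAddCommGroup H] [InnerProductSpace ℂ H] [CompleteSpace H]
  {B : VonNeumannAlgebra H} {E : Type*} [AddCommGroup E] [Module ℂ E] [Module (↥B)ᵐᵒᵖ E]
  [PreHilbertModule B E]

/-- A von Neumann module `E` consists of all intertwiners from `H` to `E ⊙ H`: the map `x ↦ L_x`
is a unitary. -/
theorem IsVonNeumannModule.exists_unitary (hE : IsVonNeumannModule B E)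
    {ρ : B.commutant →⋆ₐ[ℂ] (InteriorTensor B E →L[ℂ] InteriorTensor B E)}
    (hρ : ∀ c (x : E), ρ c ∘L creation B x = creation B x ∘L (c : H →L[ℂ] H)) :
    ∃ J : AdjointableMap B E (intertwiners ρ),
      (∀ x, (J x : H →L[ℂ] InteriorTensor B E) = creation B x) ∧
      (∀ X, (creation B (J.adjoint X) : H →L[ℂ] InteriorTensor B E) = X) := by
  have hmem (x : E) : creation B x ∈ intertwiners ρ := fun c ↦ hρ c x
  choose f hf using fun X : intertwiners ρ ↦
    hE.exists_creation_eq fun y ↦ adjoint_comp_mem (hmem y) X.2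
  refine ⟨⟨fun x ↦ ⟨creation B x, hmem x⟩, f, fun x X ↦ Subtype.ext ?_⟩, fun x ↦ rfl, hf⟩
  rw [coe_innerMod_intertwiners, ← hf X, adjoint_creation_comp_creation]

/-- The elements `x` of `E` for which `L_x` maps into a given subspace of `E ⊙ H`. -/
def submoduleInto (B : VonNeumannAlgebra H) {E : Type*} [AddCommGroup E] [Module ℂ E]
    [Module (↥B)ᵐᵒᵖ E] [PreHilbertModule B E] (N : Submodule ℂ (InteriorTensor B E)) :
    Submodule ℂ E where
  carrier := {x | ∀ h, creation B x h ∈ N}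
  add_mem' hx hy h := by
    rw [creation_add]
    exact N.add_mem (hx h) (hy h)
  zero_mem' h := by
    have : creation B (0 : E) = 0 := by simpa using creation_smul B 0 (0 : E)
    rw [this]
    exact N.zero_mem
  smul_mem' c x hx h := by
    rw [creation_smul]
    exact N.smul_mem c (hx h)

variable {N : Submodule ℂ (InteriorTensor B E)}

instance : SMul (↥B)ᵐᵒᵖ (submoduleInto B N) where
  smul b x := ⟨b • (x : E), fun h ↦ by
    rw [← MulOpposite.op_unop b, creation_op_smul]
    exact x.2 _⟩

instance : Module (↥B)ᵐᵒᵖ (submoduleInto B N) where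
  one_smul _ := Subtype.ext (one_smul _ _)
  mul_smul _ _ _ := Subtype.ext (mul_smul _ _ _)
  smul_zero _ := Subtype.ext (smul_zero _)
  smul_add _ _ _ := Subtype.ext (smul_add _ _ _)
  add_smul _ _ _ := Subtype.ext (add_smul _ _ _)
  zero_smul _ := Subtype.ext (zero_smul _ _)

noncomputable instance : PreHilbertModule B (submoduleInto B N) where
  innerProd x y := innerMod B (x : E) (y : E)
  smul_op_smul _ _ _ := Subtype.ext (PreHilbertModule.smul_op_smul _ _ _)
  op_smul_smul _ _ _ := Subtype.ext (PreHilbertModule.op_smul_smul _ _ _)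
  innerProd_self_nonneg _ := innerMod_self_nonneg _
  eq_zero_of_innerProd_self _ h := Subtype.ext (eq_zero_of_innerProd_self (A := B) _ h)
  innerProd_op_smul _ _ _ := innerMod_op_smul_right _ _ _
  star_innerProd _ _ := star_innerMod _ _
  innerProd_add _ _ _ := innerMod_add_right _ _ _
  innerProd_smul _ _ _ := innerMod_smul_right _ _ _

theorem innerMod_submoduleInto (x y : submoduleInto B N) :
    innerMod B x y = innerMod B (x : E) (y : E) := rfl

/-- Through the isometry from the interior tensor product of the submodule with `H` into `E ⊙ H`,
strong closedness is inherited from `E` and from the closed subspace `N`. -/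
theorem isVonNeumannModule_submoduleInto (hE : IsVonNeumannModule B E)
    (hN : IsClosed (N : Set (InteriorTensor B E))) :
    IsVonNeumannModule B (submoduleInto B N) := by
  obtain ⟨U, hU, hinj⟩ := (isTotalFamily_creation B (E := submoduleInto B N)).exists_injective_clm
    (fun x ↦ creation B (x : E)) fun x y ↦ by
      rw [adjoint_creation_comp_creation, adjoint_creation_comp_creation, innerMod_submoduleInto]
  have hU' (x : submoduleInto B N) (h : H) : U (creation B x h) = creation B (x : E) h :=
    DFunLike.congr_fun (hU x) h
  have : {T : H →Lₚₜ[ℂ] InteriorTensor B (submoduleInto B N) |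
        ∃ x, ∀ h : H, T h = creation B x h} =
      PointwiseConvergenceCLM.postcomp H U ⁻¹'
        {T : H →Lₚₜ[ℂ] InteriorTensor B E | ∃ x : E, ∀ h : H, T h = creation B x h} ∩
      ⋂ h : H, {T | U (T h) ∈ N} := by
    ext T
    simp only [Set.mem_inter_iff, Set.mem_preimage, Set.mem_iInter, Set.mem_ofPred_eq]
    constructor
    · rintro ⟨x, hx⟩
      exact ⟨⟨x, fun h ↦ (congrArg U (hx h)).trans (hU' x h)⟩,
        fun h ↦ by rw [hx, hU']; exact x.2 h⟩
    · rintro ⟨⟨x, hx⟩, hT⟩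
      have hx' (h : H) : U (T h) = creation B x h := hx h
      let y : submoduleInto B N := ⟨x, fun h ↦ by rw [← hx']; exact hT h⟩
      exact ⟨y, fun h ↦ hinj ((hx' h).trans (hU' y h).symm)⟩
  rw [IsVonNeumannModule, this]
  refine (IsClosed.preimage (ContinuousLinearMap.continuous _) hE).inter
    (isClosed_iInter fun h ↦ hN.preimage ?_)
  exact U.continuous.comp (continuous_eval_const h)

/-- The orthogonal projection onto a subspace of `E ⊙ H` that is invariant under the commutant
restricts to a projection of the von Neumann module `E`. -/
theorem IsVonNeumannModule.exists_projection (hE : IsVonNeumannModule B E)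
    {ρ : B.commutant →⋆ₐ[ℂ] (InteriorTensor B E →L[ℂ] InteriorTensor B E)}
    (hρ : ∀ c (x : E), ρ c ∘L creation B x = creation B x ∘L (c : H →L[ℂ] H))
    [N.HasOrthogonalProjection] (hN : ∀ c, ∀ k ∈ N, ρ c k ∈ N) :
    ∃ S : AdjointableMap B E (submoduleInto B N), S.IsCoisometry ∧
      ∀ x, (S.adjoint x : E) = x := by
  obtain ⟨J, hJ, hJ'⟩ := hE.exists_unitary hρ
  have hP (c : B.commutant) : ρ c ∘L N.starProjection = N.starProjection ∘L ρ c := by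
    ext k
    have h1 := hN c _ (N.starProjection_apply_mem k)
    have h2 : ρ c (k - N.starProjection k) ∈ Nᗮ := by
      refine (Submodule.mem_orthogonal _ _).2 fun n hn ↦ ?_
      rw [← adjoint_inner_left, ← ContinuousLinearMap.star_eq_adjoint, ← map_star]
      exact (Submodule.mem_orthogonal _ _).1 (N.sub_starProjection_mem_orthogonal k) _
        (hN (star c) n hn)
    rw [map_sub] at h2
    exact (Submodule.eq_starProjection_of_mem_orthogonal h1 h2).symm
  have hS (x : E) :
      creation B (J.adjoint (compLeft _ hP (J x))) = N.starProjection ∘L creation B x := by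
    rw [hJ', coe_compLeft, hJ]
  have hfix (y : submoduleInto B N) :
      N.starProjection ∘L creation B (y : E) = creation B (y : E) :=
    ContinuousLinearMap.ext fun h ↦ N.starProjection_eq_self_iff.2 (y.2 h)
  refine ⟨⟨fun x ↦ ⟨J.adjoint (compLeft _ hP (J x)), fun h ↦ ?_⟩, Subtype.val, fun x y ↦ ?_⟩,
    fun y ↦ Subtype.ext (creation_injective B ((hS y).trans (hfix y))), fun _ ↦ rfl⟩
  · rw [hS]
    exact N.starProjection_apply_mem _
  · refine Subtype.ext ?_
    rw [innerMod_submoduleInto, ← adjoint_creation_comp_creation,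
      ← adjoint_creation_comp_creation, hS, ContinuousLinearMap.adjoint_comp,
      (isSelfAdjoint_starProjection N).adjoint_eq, ContinuousLinearMap.comp_assoc, hfix]

end Submodules

/-! ### The Stinespring space of a completely positive map -/

section Stinespring

variable {A : Type u} [CStarAlgebra A]
  {H : Type v} [NormedAddCommGroup H] [InnerProductSpace ℂ H] [CompleteSpace H]
  {B : VonNeumannAlgebra H} {τ : A →ₗ[ℂ] B}

theorem IsCompletelyPositive.map_star [PartialOrder A] [StarOrderedRing A]
    (hτ : IsCompletelyPositive τ) (a : A) : τ (star a) = star (τ a) := by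
  have hpos (a : A) (ha : 0 ≤ a) : 0 ≤ τ a := by
    obtain ⟨d, rfl⟩ := CStarAlgebra.nonneg_iff_eq_star_mul_self.1 ha
    simpa using hτ 1 (fun _ ↦ d) (fun _ ↦ 1)
  exact StarHomClass.map_star (PositiveLinearMap.mk₀ τ hpos) a

open scoped ComplexOrder in
/-- The kernel `(a, a') ↦ τ(a* a')` is positive semidefinite on families of vectors: the matrix
`τ(aᵢ* aⱼ)` over `B` factors as `Y* Y`. -/
theorem IsCompletelyPositive.posSemidef_kernel [PartialOrder A] [StarOrderedRing A]
    (hτ : IsCompletelyPositive τ) :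
    Matrix.PosSemidef (.of fun a a' : A ↦ (τ (star a * a') : H →L[ℂ] H)) := by
  have hstar (a a' : A) : star (τ (star a * a')) = τ (star a' * a) := by
    rw [← hτ.map_star, star_mul, star_star]
  refine (List.TFAE.out RKHS.posSemidef_tfae 0 2 rfl rfl).2 ⟨?_, fun f ↦ ?_⟩
  · ext1 a a'
    exact congrArg Subtype.val (hstar a' a)
  let e := f.support.equivFin
  obtain ⟨y, hy⟩ := exists_gram_of_forall_column_nonneg
    (fun i j ↦ τ (star (e.symm i : A) * (e.symm j : A))) (fun i j ↦ hstar _ _) (fun b ↦ by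
      rw [Finset.sum_comm]
      exact hτ _ (fun i ↦ (e.symm i : A)) b)
  have hy' (i j) : (τ (star (e.symm i : A) * (e.symm j : A)) : H →L[ℂ] H) =
      ∑ k, star (y k i : H →L[ℂ] H) * (y k j : H →L[ℂ] H) := by
    rw [hy]
    exact map_sum B.toStarSubalgebra.subtype _ _
  have := re_sum_inner_gram_nonneg (fun k i ↦ (y k i : H →L[ℂ] H)) fun i ↦ f (e.symm i)
  have hsum (g : A → ℝ) : ∑ a ∈ f.support, g a = ∑ i, g (e.symm i) := by
    rw [← Finset.sum_coe_sort, ← e.symm.sum_comp]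
  simp only [← hy', Complex.re_sum] at this
  simp only [Finsupp.sum, map_sum, hsum]
  refine this.trans_eq (Finset.sum_congr rfl fun j _ ↦ Finset.sum_congr rfl fun i _ ↦ ?_)
  exact inner_re_symm (𝕜 := ℂ) _ _

/-- The Stinespring space of a completely positive map `τ`: a Hilbert space with a total family
of operators `L_a` such that `L_a* L_a' = τ(a* a')`. -/
theorem IsCompletelyPositive.exists_stinespring [PartialOrder A] [StarOrderedRing A]
    (hτ : IsCompletelyPositive τ) :
    ∃ (K : Type (max u v)) (_ : NormedAddCommGroup K) (_ : InnerProductSpace ℂ K)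
      (_ : CompleteSpace K) (L : A → H →L[ℂ] K), IsTotalFamily L ∧
      ∀ a a', adjoint (L a) ∘L L a' = (τ (star a * a') : H →L[ℂ] H) := by
  have : Fact (Matrix.PosSemidef (.of fun a a' : A ↦ (τ (star a * a') : H →L[ℂ] H))) :=
    ⟨hτ.posSemidef_kernel⟩
  refine ⟨RKHS.OfKernel (.of fun a a' : A ↦ (τ (star a * a') : H →L[ℂ] H)), inferInstance,
    inferInstance, inferInstance, RKHS.kerFun _, ?_, fun a a' ↦ ?_⟩
  · refine isTotalFamily_of_dense_span (Submodule.dense_iff_topologicalClosure_eq_top.2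
      (RKHS.kerFun_dense _)) ?_
    rintro _ ⟨a, h, rfl⟩
    exact ⟨a, h, rfl⟩
  · rw [← RKHS.kernel_apply, RKHS.OfKernel.kernel_ofKernel]
    rfl

variable {K : Type*} [NormedAddCommGroup K] [InnerProductSpace ℂ K] [CompleteSpace K]
  {L : A → H →L[ℂ] K}

/-- The Stinespring representation `π(a) L_x = L_{a x}` of `A`. -/
theorem IsTotalFamily.exists_stinespringRep [PartialOrder A] [StarOrderedRing A]
    (hL : IsTotalFamily L)
    (hLτ : ∀ a a', adjoint (L a) ∘L L a' = (τ (star a * a') : H →L[ℂ] H)) :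
    ∃ π : A →⋆ₐ[ℂ] (K →L[ℂ] K), ∀ a a', π a ∘L L a' = L (a * a') := by
  have hex (a : A) : ∃ D : K →L[ℂ] K, ∀ a', D ∘L L a' = L (a * a') := by
    obtain ⟨d, hd⟩ := exists_add_star_mul_self_eq (star_mul_self_nonneg a)
    refine hL.exists_clm _ (fun a' ↦ L (d * a')) ‖star a * a‖ fun x y ↦ ?_
    have h1 : star (a * x) * (a * y) + star (d * x) * (d * y) =
        ((‖star a * a‖ : ℝ) : ℂ) • (star x * y) := by
      calc _ = star x * (star a * a + star d * d) * y := by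
            simp only [star_mul, mul_add, add_mul, mul_assoc]
        _ = _ := by rw [hd, mul_smul_comm, mul_one, smul_mul_assoc]
    rw [hLτ, hLτ, hLτ]
    have h2 := congrArg (fun x ↦ (τ x : H →L[ℂ] H)) h1
    simp only [map_add, map_smul] at h2
    exact h2
  choose D hD using hex
  have hadd (a b : A) : L (a + b) = L a + L b := hL.eq_of_adjoint_comp fun x ↦ by
    rw [ContinuousLinearMap.comp_add, hLτ, hLτ, hLτ, mul_add, map_add]
    rfl
  have hsmul (c : ℂ) (a : A) : L (c • a) = c • L a := hL.eq_of_adjoint_comp fun x ↦ by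
    rw [ContinuousLinearMap.comp_smul, hLτ, hLτ, mul_smul_comm, map_smul]
    rfl
  refine ⟨{ toFun := D
            map_one' := hL.ext_clm fun x ↦ by rw [hD, one_mul]; rfl
            map_mul' := fun a b ↦ hL.ext_clm fun x ↦ by
              rw [hD, ContinuousLinearMap.mul_def, ContinuousLinearMap.comp_assoc, hD, hD,
                mul_assoc]
            map_zero' := hL.ext_clm fun x ↦ by
              rw [hD, zero_mul, ContinuousLinearMap.zero_comp]
              simpa using hsmul 0 0
            map_add' := fun a b ↦ hL.ext_clm fun x ↦ by
              rw [hD, ContinuousLinearMap.add_comp, hD, hD, add_mul, hadd]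
            commutes' := fun r ↦ hL.ext_clm fun x ↦ by
              rw [hD, Algebra.algebraMap_eq_smul_one, Algebra.algebraMap_eq_smul_one,
                smul_mul_assoc, one_mul, hsmul]
              rfl
            map_star' := fun a ↦ hL.eq_of_adjoint_comp_comp hL fun x y ↦ ?_ }, hD⟩
  rw [hD, hLτ, ContinuousLinearMap.star_eq_adjoint, ← ContinuousLinearMap.comp_assoc,
    ← ContinuousLinearMap.adjoint_comp, hD, hLτ, star_mul, mul_assoc]

end Stinespring

/-! ### Dilation of `τ`-maps -/

section TauMap

open PreHilbertModule

variable {A : Type*} [CStarAlgebra A] [PartialOrder A] [StarOrderedRing A]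
  {H : Type*} [NormedAddCommGroup H] [InnerProductSpace ℂ H] [CompleteSpace H]
  {B : VonNeumannAlgebra H}
  {E : Type*} [AddCommGroup E] [Module ℂ E] [Module Aᵐᵒᵖ E] [PreHilbertModule A E]
  {E' : Type*} [AddCommGroup E'] [Module ℂ E'] [Module (↥B)ᵐᵒᵖ E'] [PreHilbertModule B E']
  {τ : A →ₗ[ℂ] B} {T : E → E'}
  {K : Type*} [NormedAddCommGroup K] [InnerProductSpace ℂ K] [CompleteSpace K]
  {L : A → H →L[ℂ] K}

/-- A `τ`-map `T` dilates to operators `W_x : K → E' ⊙ H`, `L_a h ↦ T(x a) ⊙ h`, on the Stinespring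
space of `τ`. -/
theorem IsTauMap.exists_dilation (hT : IsTauMap τ T) (hL : IsTotalFamily L)
    (hLτ : ∀ a a', adjoint (L a) ∘L L a' = (τ (star a * a') : H →L[ℂ] H)) (x : E) :
    ∃ W : K →L[ℂ] InteriorTensor B E',
      ∀ a, W ∘L L a = creation B (T (MulOpposite.op a • x)) := by
  obtain ⟨d, hd⟩ := exists_add_star_mul_self_eq (innerMod_self_nonneg (A := A) x)
  refine hL.exists_clm _ (fun a ↦ L (d * a)) ‖innerMod A x x‖ fun a a' ↦ ?_
  have h1 : innerMod A (MulOpposite.op a • x) (MulOpposite.op a' • x) +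
      star (d * a) * (d * a') = ((‖innerMod A x x‖ : ℝ) : ℂ) • (star a * a') := by
    rw [innerMod_op_smul_left, innerMod_op_smul_right]
    calc _ = star a * (innerMod A x x + star d * d) * a' := by
          simp only [star_mul, mul_add, add_mul, mul_assoc]
      _ = _ := by rw [hd, mul_smul_comm, mul_one, smul_mul_assoc]
  rw [adjoint_creation_comp_creation, hT, hLτ, hLτ]
  have h2 := congrArg (fun x ↦ (τ x : H →L[ℂ] H)) h1
  simp only [map_add, map_smul] at h2
  exact h2

end TauMap

theorem mainTheorem1
    {A : Type u} [CStarAlgebra A] [PartialOrder A] [StarOrderedRing A]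
    {H : Type v} [NormedAddCommGroup H] [InnerProductSpace ℂ H] [CompleteSpace H]
    (B : VonNeumannAlgebra H)
    {E : Type w} [AddCommGroup E] [Module ℂ E] [Module Aᵐᵒᵖ E] [PreHilbertModule A E]
    (hE : PreHilbertModule.IsHilbertModule A E)
    {E' : Type z} [AddCommGroup E'] [Module ℂ E'] [Module (↥B)ᵐᵒᵖ E'] [PreHilbertModule B E']
    (hE' : IsVonNeumannModule B E')
    (τ : A →ₗ[ℂ] B) (hτ : IsCompletelyPositive τ)
    (T : E → E') (hT : IsTauMap τ T) :
    ∃ (F : Type (max u v)) (_ : AddCommGroup F) (_ : Module ℂ F) (_ : Module (↥B)ᵐᵒᵖ F)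
      (_ : PreHilbertModule B F)
      (π : A →⋆ₐ[ℂ] AdjointableMap B F F) (V : AdjointableMap B B F),
      IsVonNeumannModule B F ∧
      (∀ (a : A) (b : B), τ a * b = V.adjoint (π a (V b))) ∧
      ∃ (F' : Type z) (_ : AddCommGroup F') (_ : Module ℂ F') (_ : Module (↥B)ᵐᵒᵖ F')
        (_ : PreHilbertModule B F')
        (Ψ : E → AdjointableMap B F F') (S : AdjointableMap B E' F'),
        IsVonNeumannModule B F' ∧
        IsQuasiRepresentation π Ψ ∧
        S.IsCoisometry ∧
        ∀ (x : E) (b : B), MulOpposite.op b • T x = S.adjoint (Ψ x (V b)) := by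
  obtain ⟨K, _, _, _, L, hL, hLτ⟩ := hτ.exists_stinespring
  obtain ⟨ρ, hρ⟩ := hL.exists_commutantRep B fun a a' ↦ by rw [hLτ]; exact (τ _).2
  obtain ⟨π, hπ⟩ := hL.exists_stinespringRep hLτ
  obtain ⟨ρ', hρ'⟩ := (isTotalFamily_creation B (E := E')).exists_commutantRep B
    (adjoint_creation_comp_creation_mem B)
  choose W hW using hT.exists_dilation hL hLτ
  have hρπ (a : A) (c : B.commutant) : ρ c ∘L π a = π a ∘L ρ c := hL.ext_clm fun a' ↦ by
    rw [ContinuousLinearMap.comp_assoc, hπ, hρ, ContinuousLinearMap.comp_assoc, hρ,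
      ← ContinuousLinearMap.comp_assoc, hπ]
  have hρW (x : E) (c : B.commutant) : ρ' c ∘L W x = W x ∘L ρ c := hL.ext_clm fun a ↦ by
    rw [ContinuousLinearMap.comp_assoc, hW, hρ', ContinuousLinearMap.comp_assoc, hρ,
      ← ContinuousLinearMap.comp_assoc, hW]
  have hWW (x y : E) : adjoint (W y) ∘L W x = adjoint (π (innerMod A x y)) :=
    hL.eq_of_adjoint_comp_comp hL fun a a' ↦ by
      rw [ContinuousLinearMap.comp_assoc, hW, ← ContinuousLinearMap.comp_assoc,
        ← ContinuousLinearMap.adjoint_comp, hW, adjoint_creation_comp_creation, hT,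
        ← ContinuousLinearMap.comp_assoc (adjoint (L a)), ← ContinuousLinearMap.adjoint_comp, hπ,
        hLτ, PreHilbertModule.innerMod_op_smul_left, PreHilbertModule.innerMod_op_smul_right,
        star_mul, PreHilbertModule.star_innerMod, mul_assoc]
  -- `N` is the closed span of the vectors `T(x) ⊙ h`, written as an orthogonal complement
  let N₀ : Submodule ℂ (InteriorTensor B E') :=
    ⨅ x, LinearMap.ker (adjoint (creation B (T x)) : InteriorTensor B E' →ₗ[ℂ] H)
  have hN₀ (k) : k ∈ N₀ ↔ ∀ x, adjoint (creation B (T x)) k = 0 := by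
    simp [N₀]
  let N := N₀ᗮ
  have hρN (c : B.commutant) (k) (hk : k ∈ N) : ρ' c k ∈ N := by
    refine (Submodule.mem_orthogonal _ _).2 fun n hn ↦ ?_
    rw [← adjoint_inner_left, ← ContinuousLinearMap.star_eq_adjoint, ← map_star]
    refine (Submodule.mem_orthogonal _ _).1 hk _ ((hN₀ _).2 fun x ↦ ?_)
    have hmem : creation B (T x) ∈ intertwiners ρ' := fun c ↦ hρ' c _
    refine (DFunLike.congr_fun (adjoint_comp_rep hmem (star c)) n).trans ?_
    rw [ContinuousLinearMap.comp_apply, (hN₀ n).1 hn, map_zero]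
  have hWN (x : E) (k : K) : W x k ∈ N := by
    refine (Submodule.mem_orthogonal _ _).2 fun n hn ↦ ?_
    rw [← adjoint_inner_left]
    have : adjoint (W x) n = 0 := hL.eq_zero_of_inner fun a h ↦ by
      rw [adjoint_inner_right, ← ContinuousLinearMap.comp_apply, hW, ← adjoint_inner_right,
        (hN₀ n).1 hn, inner_zero_right]
    rw [this, inner_zero_left]
  obtain ⟨J, -, hJ'⟩ := hE'.exists_unitary hρ'
  obtain ⟨S, hS, hS'⟩ := hE'.exists_projection hρ' hρN
  let Ψ (x : E) : AdjointableMap B (intertwiners ρ) (submoduleInto B N) :=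
    S.comp (J.adjoint.comp (compLeft (W x) (hρW x)))
  have hΨ (x : E) (X : intertwiners ρ) :
      creation B (Ψ x X : E') = W x ∘L (X : H →L[ℂ] K) := by
    have h1 := hJ' (compLeft (W x) (hρW x) X)
    rw [coe_compLeft] at h1
    -- `S` fixes `y`, because `y` lies in the range of the inclusion `S*`
    let y : submoduleInto B N :=
      ⟨J.adjoint (compLeft (W x) (hρW x) X), fun h ↦ by rw [h1]; exact hWN x _⟩
    have h2 : Ψ x X = y := (congrArg S (hS' y)).symm.trans (hS y)
    rw [h2]
    exact h1
  refine ⟨intertwiners ρ, inferInstance, inferInstance, inferInstance, inferInstance,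
    compLeftRep π hρπ, AdjointableMap.ofElement ⟨L 1, fun c ↦ hρ c 1⟩,
    isVonNeumannModule_intertwiners ρ, fun a b ↦ Subtype.ext ?_,
    submoduleInto B N, inferInstance, inferInstance, inferInstance, inferInstance, Ψ, S,
    isVonNeumannModule_submoduleInto hE' (Submodule.isClosed_orthogonal _),
    fun x y X Y ↦ Subtype.ext ?_, hS, fun x b ↦ creation_injective B ?_⟩
  · change (τ a : H →L[ℂ] H) ∘L (b : H →L[ℂ] H) =
      adjoint (L 1) ∘L π a ∘L L 1 ∘L (b : H →L[ℂ] H)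
    rw [← ContinuousLinearMap.comp_assoc (π a), hπ, ← ContinuousLinearMap.comp_assoc, hLτ,
      star_one, one_mul, mul_one]
  · rw [innerMod_submoduleInto, ← adjoint_creation_comp_creation, hΨ, hΨ,
      coe_innerMod_intertwiners, coe_compLeftRep, ContinuousLinearMap.adjoint_comp,
      ContinuousLinearMap.adjoint_comp, ← hWW]
    simp only [ContinuousLinearMap.comp_assoc]
  · change creation B (MulOpposite.op b • T x) = creation B (S.adjoint _)
    rw [hS', hΨ, creation_op_smul]
    change _ = W x ∘L L 1 ∘L (b : H →L[ℂ] H)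
    rw [← ContinuousLinearMap.comp_assoc, hW, MulOpposite.op_one, one_smul]
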